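/- **Theorem (non-Archimedean Eda's theorem).** Let $k$ be a field that is complete with respect to a multiplicative non-Archimedean norm $|\cdot|$ whose value set $|k|$ is dense in $\mathbb{R}_{\geq 0}$. Let $\kappa$ be an infinite cardinal or the class $\mathrm{Card}$ of all cardinals; in the second case every set has "cardinality less than $\kappa$". Suppose that no set of cardinality less than $\kappa$ is $\omega_1$-measurable, where a set is $\omega_1$-measurable if it is uncountable and carries a non-principal ultrafilter closed under countable intersections. A Banach $k$-vector space is a complete normed $k$-vector space with ultrametric norm, and $\cong$ denotes isometric $k$-linear isomorphism. For a family $W=(W(i))_{i\in I}$ of Banach $k$-vector spaces, let $\Pi_I W$ be the space of all $w=(w(i))_{i \in I}$, $w(i)\in W(i)$, with $\sup_i\|w(i)\|<\infty$, with the supremum norm, and let $\Sigma_I W\subset\Pi_I W$ be the closed subspace of those $w$ such that $\{i \in I:\|w(i)\|\geq\epsilon\}$ is finite for every $\epsilon>0$. Finite powers $k^d$ and products $V\times W$ carry the maximum norm. All classes below are closed under $\cong$, and $\alpha,\beta$ denote ordinals. * $F_k$ is the class of all $V$ with $V\cong k^d$ for some integer $d\geq 0$. * *Reid hierarchy.*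 $\Pi_0=\Sigma_0=F_k$. For $\alpha\neq 0$, $\Pi_\alpha$ (resp. $\Sigma_\alpha$) is the class of all $V\cong\Pi_I W$ (resp. $V\cong\Sigma_I W$) with $\#I<\kappa$ and $W(i)\in\bigcup_{\beta<\alpha}(\Pi_\beta\cup\Sigma_\beta)$ for all $i\in I$. The Reid class is $\mathscr{R}=\bigcup_\alpha(\Pi_\alpha\cup\Sigma_\alpha)$. * *Pure Reid hierarchy.* $\mathrm{P}\Pi_0=\mathrm{P}\Sigma_0$ is the class of all $V\cong k$. Write $\mathrm{P}\Pi_{<\alpha}=\bigcup_{\beta<\alpha}\mathrm{P}\Pi_\beta$ and $\mathrm{P}\Sigma_{<\alpha}=\bigcup_{\beta<\alpha}\mathrm{P}\Sigma_\beta$. For $\alpha\neq 0$, $\mathrm{P}\Pi_\alpha$ is the class of all $V\cong\Pi_I W$ with $\#I<\kappa$ and $W(i)\in\mathrm{P}\Pi_{<\alpha}\cup\mathrm{P}\Sigma_{<\alpha}$ for all $i\in I$, such that for every $\beta<\alpha$ there are infinitely many $i\in I$ with $W(i)\in\mathrm{P}\Sigma_{<\alpha}\setminus\mathrm{P}\Sigma_{<\beta}$.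 The class $\mathrm{P}\Sigma_\alpha$ is defined in the same way with $\Pi$ and $\Sigma$ exchanged. * *Mixed classes.* $\mathrm{M}\mathscr{R}_\alpha$ is the class of all $V\cong P\times S$ with $P\in\mathrm{P}\Pi_\alpha$ and $S\in\mathrm{P}\Sigma_\alpha$. Then $F_k$ and the classes $\mathrm{M}\mathscr{R}_\alpha$, $\mathrm{P}\Pi_\alpha$, $\mathrm{P}\Sigma_\alpha$ with $\alpha\neq 0$ are subclasses of $\mathscr{R}$, and any two of them with different labels are disjoint (some of them may be empty). If moreover $\kappa$ is a regular cardinal or $\kappa=\mathrm{Card}$, then their union is $\mathscr{R}$; that is, $\mathscr{R}$ is the disjoint union of $F_k$ and of the classes $\mathrm{M}\mathscr{R}_\alpha$, $\mathrm{P}\Pi_\alpha$ and $\mathrm{P}\Sigma_\alpha$ over all nonzero ordinals $\alpha$. -/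

import Mathlib

universe u

open scoped ENNReal Cardinal

noncomputable section

namespace NAReid

/-- A Banach space over a complete non-Archimedean valued field `k`: a complete normed `k`-vector
space whose norm satisfies the strong triangle inequality. -/
structure Ban (k : Type u) [NormedField k] : Type (u + 1) where
  carrier : Type u
  [instGroup : NormedAddCommGroup carrier]
  [instSpace : NormedSpace k carrier]
  [instComplete : CompleteSpace carrier]
  [instUltra : IsUltrametricDist carrier]

attribute [instance] Ban.instGroup Ban.instSpace Ban.instComplete Ban.instUltra

variable {k : Type u} [NormedField k]

/-- Isomorphism of Banach `k`-vector spaces: the existence of an isometric `k`-linear bijection. -/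
def Ban.Iso (V W : Ban k) : Prop := Nonempty (V.carrier ≃ₗᵢ[k] W.carrier)

section sums

variable {I : Type u} (W : I → Ban k)

theorem norm_add_le_max_lp (x y : lp (fun i => (W i).carrier) ∞) : ‖x + y‖ ≤ max ‖x‖ ‖y‖ := by
  refine lp.norm_le_of_forall_le (le_max_of_le_left (norm_nonneg x)) fun i => ?_
  refine (IsUltrametricDist.norm_add_le_max (x i) (y i)).trans ?_
  exact max_le_max (lp.norm_apply_le_norm (by simp) x i) (lp.norm_apply_le_norm (by simp) y i)

instance isUltrametricDist_lp : IsUltrametricDist (lp (fun i => (W i).carrier) ∞) :=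
  IsUltrametricDist.isUltrametricDist_of_forall_norm_add_le_max_norm (norm_add_le_max_lp W)

/-- The bounded direct product `Π_I W`: all families `w` with `w i ∈ W i` and `sup ‖w i‖ < ∞`, with
the supremum norm (which is `0` on the only element if `I` is empty). -/
def boundedProd : Ban k where
  carrier := lp (fun i => (W i).carrier) ∞

/-- The families `w` in the bounded direct product such that `{i | ε ≤ ‖w i‖}` is finite for every
`ε > 0`. -/
def nullFamilies : Submodule k (lp (fun i => (W i).carrier) ∞) where
  carrier := {w | ∀ ε : ℝ, 0 < ε → {i | ε ≤ ‖w i‖}.Finite}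
  zero_mem' := by
    intro ε hε
    simp [hε.not_ge]
  add_mem' := by
    intro x y hx hy ε hε
    refine ((hx ε hε).union (hy ε hε)).subset fun i hi => ?_
    exact le_max_iff.1 (le_trans hi (IsUltrametricDist.norm_add_le_max (x i) (y i)))
  smul_mem' := by
    intro c x hx ε hε
    by_cases hc : c = 0
    · simp [hc, hε.not_ge]
    · have hc' : 0 < ‖c‖ := norm_pos_iff.2 hc
      refine (hx (ε / ‖c‖) (div_pos hε hc')).subset fun i hi => ?_
      have hi' : ε ≤ ‖c • x i‖ := hi
      rw [norm_smul] at hi'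
      exact (div_le_iff₀' hc').2 hi'

theorem isClosed_nullFamilies : IsClosed (nullFamilies W : Set (lp (fun i => (W i).carrier) ∞)) := by
  refine isClosed_of_closure_subset fun x hx ε hε => ?_
  obtain ⟨y, hy, hxy⟩ := Metric.mem_closure_iff.1 hx ε hε
  refine (hy ε hε).subset fun i hi => ?_
  by_contra h
  have h1 : ‖x i - y i‖ < ε := by
    refine (lp.norm_apply_le_norm (by simp) (x - y) i).trans_lt ?_
    rwa [← dist_eq_norm]
  have h2 : ‖x i‖ ≤ max ‖x i - y i‖ ‖y i‖ := by
    simpa using IsUltrametricDist.norm_add_le_max (x i - y i) (y i)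
  exact absurd (le_trans hi h2) (not_le.2 (max_lt h1 (not_le.1 h)))

instance completeSpace_nullFamilies : CompleteSpace (nullFamilies W) :=
  (isClosed_nullFamilies W).completeSpace_coe

instance isUltrametricDist_nullFamilies : IsUltrametricDist (nullFamilies W) :=
  IsUltrametricDist.isUltrametricDist_of_forall_norm_add_le_max_norm
    fun x y => norm_add_le_max_lp W x y

/-- The completed direct sum `Σ_I W`: the closed subspace of the bounded direct product that
consists of the families tending to `0`. -/
def completedSum : Ban k where
  carrier := nullFamilies W

end sums

/-- The two symbols `Π` and `Σ`. -/
inductive Kind : Type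
  | pi
  | sigma

/-- The exchange of `Π` and `Σ`. -/
def Kind.dual : Kind → Kind
  | .pi => .sigma
  | .sigma => .pi

/-- `A_I W`, where `A` is one of the symbols `Π` and `Σ`. -/
def aggregate (A : Kind) {I : Type u} (W : I → Ban k) : Ban k :=
  match A with
  | .pi => boundedProd W
  | .sigma => completedSum W

/-- The class `Set_{<κ}`. A value `κ ≠ ⊤` is a cardinal number and bounds the cardinality of the
index sets strictly; the value `κ = ⊤` stands for the class of all cardinals, so that all
index sets are allowed. -/
def IsSmall (κ : WithTop Cardinal.{u}) (I : Type u) : Prop :=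
  ((#I : Cardinal.{u}) : WithTop Cardinal.{u}) < κ

/-- `X` is `lam`-measurable: it is uncountable and has a `lam`-complete non-principal ultrafilter. -/
def IsMeasurableSet (lam : Cardinal.{u}) (X : Type u) : Prop :=
  Uncountable X ∧
    ∃ F : Ultrafilter X, CardinalInterFilter (F : Filter X) lam ∧ ∀ x : X, F ≠ pure x

/-- The non-measurability condition: no set of cardinality less than `κ` is `ω₁`-measurable. -/
def NonMeasurability (κ : WithTop Cardinal.{u}) : Prop :=
  ∀ X : Type u, IsSmall κ X → ¬ IsMeasurableSet ℵ₁ X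

variable (k) in
/-- `F_k`: the Banach spaces isometrically isomorphic to some `k ^ d` with the maximum norm. -/
def finiteClass : Set (Ban k) :=
  {V | ∃ d : ℕ, Nonempty (V.carrier ≃ₗᵢ[k] (Fin d → k))}

/-- The levels `Π_α` and `Σ_α` of the Reid hierarchy. Level `0` is `F_k` for both symbols. For
`α ≠ 0` the class `A_α` consists of all spaces isomorphic to `A_I W` for a `κ`-small `I` and a
family `W` of members of the classes `Π_β` and `Σ_β` with `β < α`. -/
def reidLevel (κ : WithTop Cardinal.{u}) (α : Ordinal.{u}) (A : Kind) : Set (Ban k) :=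
  {V | (α = 0 ∧ V ∈ finiteClass k) ∨
    (α ≠ 0 ∧ ∃ (I : Type u) (W : I → Ban k), IsSmall κ I ∧
      (∀ i, ∃ (β : Ordinal.{u}) (_ : β < α) (B : Kind), W i ∈ reidLevel κ β B) ∧
      V.Iso (aggregate A W))}
termination_by α

variable (k) in
/-- The Reid class `R`: the union of all levels of the Reid hierarchy. -/
def reidClass (κ : WithTop Cardinal.{u}) : Set (Ban k) :=
  {V | ∃ (α : Ordinal.{u}) (A : Kind), V ∈ reidLevel κ α A}

/-- The levels `PΠ_α` and `PΣ_α` of the pure Reid hierarchy. Level `0` is the class of spaces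
isomorphic to `k` for both symbols. For `α ≠ 0` the class `PA_α` consists of all spaces isomorphic
to `A_I W` for a `κ`-small `I` and a family `W` of members of the classes `PΠ_β` and `PΣ_β` with
`β < α` such that, with `B` the other symbol, for every `β < α` there are infinitely many `i` with
`W i ∈ PB_{<α} \ PB_{<β}`. -/
def pureLevel (κ : WithTop Cardinal.{u}) (α : Ordinal.{u}) (A : Kind) : Set (Ban k) :=
  {V | (α = 0 ∧ Nonempty (V.carrier ≃ₗᵢ[k] k)) ∨
    (α ≠ 0 ∧ ∃ (I : Type u) (W : I → Ban k), IsSmall κ I ∧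
      (∀ i, ∃ (β : Ordinal.{u}) (_ : β < α) (B : Kind), W i ∈ pureLevel κ β B) ∧
      (∀ (β : Ordinal.{u}) (_ : β < α),
        {i | (∃ (γ : Ordinal.{u}) (_ : γ < α), W i ∈ pureLevel κ γ A.dual) ∧
          ¬ ∃ (γ : Ordinal.{u}) (_ : γ < β), W i ∈ pureLevel κ γ A.dual}.Infinite) ∧
      V.Iso (aggregate A W))}
termination_by α
decreasing_by
  all_goals first
    | assumption
    | exact lt_trans (by assumption) (by assumption)

variable (k) in
/-- `PΠ_α`. -/
def purePi (κ : WithTop Cardinal.{u}) (α : Ordinal.{u}) : Set (Ban k) := pureLevel κ α .pi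

variable (k) in
/-- `PΣ_α`. -/
def pureSigma (κ : WithTop Cardinal.{u}) (α : Ordinal.{u}) : Set (Ban k) := pureLevel κ α .sigma

variable (k) in
/-- `MR_α`: the products `P × S`, with the maximum norm, of a `P ∈ PΠ_α` and an `S ∈ PΣ_α`. -/
def mixedClass (κ : WithTop Cardinal.{u}) (α : Ordinal.{u}) : Set (Ban k) :=
  {V | ∃ P ∈ purePi k κ α, ∃ S ∈ pureSigma k κ α,
    Nonempty (V.carrier ≃ₗᵢ[k] (P.carrier × S.carrier))}

/-- The labels of the parts of the classification. -/
inductive Part : Type (u + 1)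
  | finite
  | mixed (α : Ordinal.{u}) (hα : α ≠ 0)
  | pi (α : Ordinal.{u}) (hα : α ≠ 0)
  | sigma (α : Ordinal.{u}) (hα : α ≠ 0)

variable (k) in
/-- The classes `F_k`, `MR_α`, `PΠ_α` and `PΣ_α`, for `α ≠ 0`. -/
def part (κ : WithTop Cardinal.{u}) : Part.{u} → Set (Ban k)
  | .finite => finiteClass k
  | .mixed α _ => mixedClass k κ α
  | .pi α _ => purePi k κ α
  | .sigma α _ => pureSigma k κ α

end NAReid

end

universe v w

noncomputable section

namespace NAReid

variable {k : Type u} [NormedField k]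

/-! Everything rests on a non-Archimedean Chase lemma (`exists_small_off_finset`): a bounded linear
map from a bounded product to a completed sum is, up to a prescribed `ε`, zero off finitely many
coordinates of the source and of the target. A gliding hump argument gives this on some member of
every sequence of subproducts with supports shrinking to `∅`; if no cofinite subproduct worked,
there would be a countably complete non-principal ultrafilter on the index set, which
non-measurability forbids.

Hence, if an aggregate is a summand of an aggregate of the other kind, a cofinite part of the former
is a summand of a finite part of the latter. Since Chase's lemma leaves an error, summands are
allowed a defect of norm less than 1 (`AppRetract`); the ultrametric inequality keeps the defect
below 1. Two such cuts drive the induction in `not_appRetract`: a pure space of rank `δ ≠ 0` is not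
an approximate summand of a Reid space of the opposite kind and level at most `δ`. So rank and kind
are invariants, and the parts are disjoint.

For exhaustion, nested aggregates of one kind flatten when `κ` is regular, so every Reid space is,
for either kind, an aggregate of pure spaces of the other kind. Let `α` be least such that only
finitely many components have rank at least `α`. The components of rank below `α` form a pure or
zero space, and the finitely many others are multiplied in by absorption rules. -/

instance : CoeSort (Ban k) (Type u) := ⟨Ban.carrier⟩

theorem Ban.Iso.refl (V : Ban k) : V.Iso V := ⟨LinearIsometryEquiv.refl k V⟩

theorem Ban.Iso.symm {V W : Ban k} (h : V.Iso W) : W.Iso V := h.map fun e => e.symm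

theorem Ban.Iso.trans {U V W : Ban k} (h : U.Iso V) (h' : V.Iso W) : U.Iso W :=
  h.elim fun e => h'.map fun e' => e.trans e'

/-- The ground field as a Banach space over itself. -/
def Ban.base (k : Type u) [NormedField k] [IsUltrametricDist k] [CompleteSpace k] : Ban k where
  carrier := k

/-- The product of two Banach spaces with the maximum norm. -/
def Ban.prod (V W : Ban k) : Ban k where
  carrier := V.carrier × W.carrier
  instUltra := IsUltrametricDist.isUltrametricDist_of_forall_norm_add_le_max_norm fun x y => by
    refine max_le ((IsUltrametricDist.norm_add_le_max x.1 y.1).trans ?_)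
      ((IsUltrametricDist.norm_add_le_max x.2 y.2).trans ?_)
    · exact max_le_max (le_max_left _ _) (le_max_left _ _)
    · exact max_le_max (le_max_right _ _) (le_max_right _ _)

/-! ### Admissible norm families for both kinds -/

/-- The norm families of the members of a bounded product, respectively of a completed sum. -/
def Adm (A : Kind) {I : Type v} (n : I → ℝ) : Prop :=
  match A with
  | .pi => ∃ C, ∀ i, n i ≤ C
  | .sigma => ∀ ε : ℝ, 0 < ε → {i | ε ≤ n i}.Finite

section Adm

variable {A : Kind} {I : Type v} {J : Type w} {n m : I → ℝ}

theorem Adm.mono (hm : Adm A m) (h : ∀ i, n i ≤ m i) : Adm A n := by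
  cases A with
  | pi => exact hm.imp fun C hC i => (h i).trans (hC i)
  | sigma => exact fun ε hε => (hm ε hε).subset fun i hi => le_trans hi (h i)

theorem Adm.of_finite [Finite I] (n : I → ℝ) : Adm A n := by
  cases A with
  | pi =>
    obtain ⟨C, hC⟩ := (Set.finite_range n).bddAbove
    exact ⟨C, fun i => hC ⟨i, rfl⟩⟩
  | sigma => exact fun ε _ => Set.toFinite _

theorem Adm.comp (hn : Adm A n) {e : J → I} (he : Function.Injective e) :
    Adm A fun j => n (e j) := by
  cases A with
  | pi => exact hn.imp fun C hC j => hC (e j)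
  | sigma => exact fun ε hε => Set.Finite.preimage (f := e) he.injOn (hn ε hε)

theorem Adm.extend (hn : Adm A n) {e : I → J} {m : J → ℝ} (he : ∀ i, m (e i) ≤ n i)
    (h0 : ∀ j, j ∉ Set.range e → m j ≤ 0) : Adm A m := by
  cases A with
  | pi =>
    obtain ⟨C, hC⟩ := hn
    refine ⟨max C 0, fun j => ?_⟩
    by_cases hj : j ∈ Set.range e
    · obtain ⟨i, rfl⟩ := hj
      exact le_max_of_le_left ((he i).trans (hC i))
    · exact le_max_of_le_right (h0 j hj)
  | sigma =>
    refine fun ε hε => ((hn ε hε).image e).subset fun j hj => ?_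
    by_cases h : j ∈ Set.range e
    · obtain ⟨i, rfl⟩ := h
      exact ⟨i, le_trans hj (he i), rfl⟩
    · exact absurd (le_trans hj (h0 j h)) (not_le.2 hε)

theorem Adm.sum {n : I ⊕ J → ℝ} (hl : Adm A fun i => n (.inl i)) (hr : Adm A fun j => n (.inr j)) :
    Adm A n := by
  cases A with
  | pi =>
    obtain ⟨C, hC⟩ := hl
    obtain ⟨D, hD⟩ := hr
    refine ⟨max C D, ?_⟩
    rintro (i | j)
    · exact le_max_of_le_left (hC i)
    · exact le_max_of_le_right (hD j)
  | sigma =>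
    refine fun ε hε => (((hl ε hε).image Sum.inl).union ((hr ε hε).image Sum.inr)).subset ?_
    rintro (i | j) hi
    · exact Or.inl ⟨i, hi, rfl⟩
    · exact Or.inr ⟨j, hi, rfl⟩

theorem Adm.sigma {J : I → Type w} {n : I → ℝ} {m : (Σ i, J i) → ℝ}
    (hn : Adm A n) (hm : ∀ i, Adm A fun j => m ⟨i, j⟩) (h : ∀ i j, m ⟨i, j⟩ ≤ n i) : Adm A m := by
  cases A with
  | pi => exact hn.imp fun C hC p => (h p.1 p.2).trans (hC p.1)
  | sigma =>
    intro ε hε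
    refine ((hn ε hε).biUnion fun i _ => (hm i ε hε).image (Sigma.mk i)).subset ?_
    rintro ⟨i, j⟩ hj
    exact Set.mem_biUnion (x := i) (le_trans hj (h i j)) ⟨j, hj, rfl⟩

theorem Adm.of_sigma {J : I → Type w} {n : I → ℝ} {m : (Σ i, J i) → ℝ} (hm : Adm A m)
    (h : ∀ i (C : ℝ), 0 ≤ C → (∀ j, m ⟨i, j⟩ ≤ C) → n i ≤ C) : Adm A n := by
  cases A with
  | pi =>
    obtain ⟨C, hC⟩ := hm
    exact ⟨max C 0, fun i => h i _ (le_max_right _ _) fun j => le_max_of_le_left (hC _)⟩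
  | sigma =>
    intro ε hε
    -- Entries all below `ε` would only give `n i ≤ ε`, which is no contradiction; hence the half.
    refine ((hm (ε / 2) (half_pos hε)).image Sigma.fst).subset fun i hi => ?_
    by_contra hcon
    have := h i (ε / 2) (half_pos hε).le fun j => by
      by_contra hj
      exact hcon ⟨⟨i, j⟩, (not_le.1 hj).le, rfl⟩
    have hi' : ε ≤ n i := hi
    linarith

end Adm

/-! ### Coordinate presentations of products and completed sums -/

/-- `φ` presents `V` as the aggregate of kind `A` of the family `W`. -/
structure IsAgg (A : Kind) (V : Ban k) {I : Type v} (W : I → Ban k)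
    (φ : V →ₗ[k] ∀ i, W i) : Prop where
  norm_apply_le : ∀ v i, ‖φ v i‖ ≤ ‖v‖
  norm_le : ∀ v (C : ℝ), 0 ≤ C → (∀ i, ‖φ v i‖ ≤ C) → ‖v‖ ≤ C
  adm : ∀ v, Adm A fun i => ‖φ v i‖
  exists_of_adm : ∀ w : ∀ i, W i, (Adm A fun i => ‖w i‖) → ∃ v, φ v = w

/-- `V` is isomorphic to the aggregate of kind `A` of the family `W`. -/
def HasAgg (A : Kind) (V : Ban k) {I : Type v} (W : I → Ban k) : Prop :=
  ∃ φ : V →ₗ[k] ∀ i, W i, IsAgg A V W φ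

section IsAgg

variable {A : Kind} {V V' : Ban k} {I : Type v} {W : I → Ban k} {φ : V →ₗ[k] ∀ i, W i}
  {φ' : V' →ₗ[k] ∀ i, W i}

theorem IsAgg.injective (h : IsAgg A V W φ) : Function.Injective φ := by
  refine (injective_iff_map_eq_zero φ).2 fun v hv => ?_
  exact norm_le_zero_iff.1 (h.norm_le v 0 le_rfl fun i => by simp [hv])

/-- The linear map into an aggregate with given coordinates. -/
def IsAgg.lift (h : IsAgg A V W φ) {Y : Type w} [AddCommGroup Y] [Module k Y]
    (g : Y →ₗ[k] ∀ i, W i) (hg : ∀ y, Adm A fun i => ‖g y i‖) : Y →ₗ[k] V where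
  toFun y := (h.exists_of_adm (g y) (hg y)).choose
  map_add' x y := h.injective <| (h.exists_of_adm _ (hg (x + y))).choose_spec.trans <| by
    rw [map_add g, map_add φ, (h.exists_of_adm _ (hg x)).choose_spec,
      (h.exists_of_adm _ (hg y)).choose_spec]
  map_smul' c x := h.injective <| (h.exists_of_adm _ (hg (c • x))).choose_spec.trans <| by
    rw [map_smul g, map_smul φ, (h.exists_of_adm _ (hg x)).choose_spec, RingHom.id_apply]

@[simp]
theorem IsAgg.apply_lift (h : IsAgg A V W φ) {Y : Type w} [AddCommGroup Y] [Module k Y]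
    (g : Y →ₗ[k] ∀ i, W i) (hg : ∀ y, Adm A fun i => ‖g y i‖) (y : Y) :
    φ (h.lift g hg y) = g y :=
  (h.exists_of_adm (g y) (hg y)).choose_spec

theorem IsAgg.iso (h : IsAgg A V W φ) (h' : IsAgg A V' W φ') : V.Iso V' := by
  refine ⟨⟨LinearEquiv.ofLinearMap (h'.lift φ h.adm) (h.lift φ' h'.adm) ?_ ?_, fun v => ?_⟩⟩
  · exact LinearMap.ext fun v => h'.injective (by simp)
  · exact LinearMap.ext fun v => h.injective (by simp)
  · refine le_antisymm (h'.norm_le _ _ (norm_nonneg _) fun i => ?_)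
      (h.norm_le _ _ (norm_nonneg _) fun i => ?_)
    · simpa using h.norm_apply_le v i
    · simpa using h'.norm_apply_le (h'.lift φ h.adm v) i

theorem HasAgg.iso (h : HasAgg A V W) (h' : HasAgg A V' W) : V.Iso V' :=
  h.elim fun _ h => h'.elim fun _ h' => h.iso h'

theorem HasAgg.congr (h : HasAgg A V W) {J : Type w} {W' : J → Ban k} (hV : V'.Iso V) (e : J ≃ I)
    (he : ∀ j, (W' j).Iso (W (e j))) : HasAgg A V' W' := by
  obtain ⟨φ, h⟩ := h
  obtain ⟨f⟩ := hV
  have g := fun j => (he j).some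
  refine ⟨LinearMap.pi fun j => (g j).symm.toLinearEquiv.toLinearMap ∘ₗ LinearMap.proj (e j) ∘ₗ φ ∘ₗ
    f.toLinearEquiv.toLinearMap, ⟨fun v j => ?_, fun v C hC hv => ?_, fun v => ?_, fun w hw => ?_⟩⟩
  · simpa using h.norm_apply_le (f v) (e j)
  · rw [← f.norm_map]
    refine h.norm_le _ C hC fun i => ?_
    obtain ⟨j, rfl⟩ := e.surjective i
    simpa using hv j
  · simpa using (h.adm (f v)).comp e.injective
  · obtain ⟨v, hv⟩ := h.exists_of_adm (Equiv.piCongrLeft (fun i => (W i).carrier) e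
      fun j => g j (w j)) (hw.extend (e := e) (fun j => by
        rw [Equiv.piCongrLeft_apply_apply, (g j).norm_map]) fun i hi =>
          absurd (e.surjective i) hi)
    refine ⟨f.symm v, funext fun j => ?_⟩
    have := congrFun hv (e j)
    rw [Equiv.piCongrLeft_apply_apply] at this
    simp [this]

theorem HasAgg.of_unique [Unique I] (W : I → Ban k) : HasAgg A (W default) W := by
  refine ⟨LinearMap.pi fun i => Unique.eq_default i ▸ LinearMap.id, ?_, ?_, ?_, ?_⟩
  · intro v i
    cases Unique.eq_default i
    simp
  · intro v C _ hv
    simpa using hv default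
  · exact fun v => Adm.of_finite _
  · intro w _
    refine ⟨w default, funext fun i => ?_⟩
    cases Unique.eq_default i
    simp

theorem HasAgg.sum (h : HasAgg A V W) {J : Type w} {W' : J → Ban k} (h' : HasAgg A V' W') :
    HasAgg A (V.prod V') (Sum.elim W W') := by
  obtain ⟨φ, h⟩ := h
  obtain ⟨φ', h'⟩ := h'
  refine ⟨LinearMap.pi (Sum.rec (fun i => LinearMap.proj i ∘ₗ φ ∘ₗ LinearMap.fst k V V')
    fun j => LinearMap.proj j ∘ₗ φ' ∘ₗ LinearMap.snd k V V'), ?_, ?_, ?_, ?_⟩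
  · rintro v (i | j)
    · exact (h.norm_apply_le v.1 i).trans (le_max_left _ _)
    · exact (h'.norm_apply_le v.2 j).trans (le_max_right _ _)
  · intro v C hC hv
    exact max_le (h.norm_le v.1 C hC fun i => hv (.inl i)) (h'.norm_le v.2 C hC fun j => hv (.inr j))
  · exact fun v => Adm.sum (h.adm v.1) (h'.adm v.2)
  · intro w hw
    obtain ⟨x, hx⟩ := h.exists_of_adm (fun i => w (.inl i)) (hw.comp Sum.inl_injective)
    obtain ⟨y, hy⟩ := h'.exists_of_adm (fun i => w (.inr i)) (hw.comp Sum.inr_injective)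
    refine ⟨(x, y), funext ?_⟩
    rintro (i | j)
    · exact congrFun hx i
    · exact congrFun hy j

/-- Associativity within one kind: a double supremum is a supremum over pairs, and a double null
family is a null family of pairs. This flattens nested aggregates. -/
theorem HasAgg.sigma (h : HasAgg A V W) {J : I → Type w} {W' : ∀ i, J i → Ban k}
    (h' : ∀ i, HasAgg A (W i) (W' i)) :
    HasAgg A V fun p : Σ i, J i => W' p.1 p.2 := by
  obtain ⟨φ, h⟩ := h
  choose ψ h' using h'
  refine ⟨LinearMap.pi fun p => LinearMap.proj p.2 ∘ₗ ψ p.1 ∘ₗ LinearMap.proj p.1 ∘ₗ φ,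
    ?_, ?_, ?_, ?_⟩
  · exact fun v p => ((h' p.1).norm_apply_le _ p.2).trans (h.norm_apply_le v p.1)
  · exact fun v C hC hv => h.norm_le v C hC fun i => (h' i).norm_le _ C hC fun j => hv ⟨i, j⟩
  · exact fun v => Adm.sigma (h.adm v) (fun i => (h' i).adm (φ v i)) fun i j => (h' i).norm_apply_le _ j
  · intro w hw
    have hw' : ∀ i, ∃ v, ψ i v = fun j => w ⟨i, j⟩ := fun i =>
      (h' i).exists_of_adm _ (hw.comp (e := Sigma.mk i) sigma_mk_injective)
    choose v hv using hw'
    obtain ⟨x, hx⟩ := h.exists_of_adm v (hw.of_sigma fun i C hC hj =>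
      (h' i).norm_le _ C hC fun j => by simpa [hv] using hj j)
    exact ⟨x, funext fun p => by simp [hx, hv]⟩

end IsAgg

section aggregate

variable {I : Type u} (W : I → Ban k)

theorem hasAgg_boundedProd : HasAgg .pi (boundedProd W) W := by
  refine ⟨{ toFun := fun x => ⇑(show lp (fun i => (W i).carrier) ∞ from x)
            map_add' := fun _ _ => rfl
            map_smul' := fun _ _ => rfl }, ?_, ?_, ?_, ?_⟩
  · exact fun x i => lp.norm_apply_le_norm (by simp) (show lp (fun i => (W i).carrier) ∞ from x) i
  · exact fun x C hC h => lp.norm_le_of_forall_le hC h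
  · exact fun x => ⟨‖x‖, fun i => lp.norm_apply_le_norm (by simp)
      (show lp (fun i => (W i).carrier) ∞ from x) i⟩
  · rintro w ⟨C, hC⟩
    exact ⟨⟨w, memℓp_infty ⟨C, by rintro _ ⟨i, rfl⟩; exact hC i⟩⟩, rfl⟩

theorem hasAgg_completedSum : HasAgg .sigma (completedSum W) W := by
  refine ⟨{ toFun := fun x => ⇑(show nullFamilies W from x).1
            map_add' := fun _ _ => rfl
            map_smul' := fun _ _ => rfl }, ?_, ?_, ?_, ?_⟩
  · exact fun x i => lp.norm_apply_le_norm (by simp) (show nullFamilies W from x).1 i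
  · exact fun x C hC h => lp.norm_le_of_forall_le (f := (show nullFamilies W from x).1) hC h
  · exact fun x => (show nullFamilies W from x).2
  · intro w hw
    have hb : Memℓp w ∞ := by
      refine memℓp_infty ?_
      obtain ⟨C, hC⟩ := ((hw 1 one_pos).image fun i => ‖w i‖).bddAbove
      refine ⟨max C 1, ?_⟩
      rintro _ ⟨i, rfl⟩
      by_cases hi : 1 ≤ ‖w i‖
      · exact le_max_of_le_left (hC ⟨i, hi, rfl⟩)
      · exact le_max_of_le_right (not_le.1 hi).le
    exact ⟨⟨⟨w, hb⟩, hw⟩, rfl⟩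

theorem hasAgg_aggregate (A : Kind) : HasAgg A (aggregate A W) W := by
  cases A
  · exact hasAgg_boundedProd W
  · exact hasAgg_completedSum W

variable {W} {A : Kind} {V : Ban k}

theorem hasAgg_iff_iso : HasAgg A V W ↔ V.Iso (aggregate A W) :=
  ⟨fun h => h.iso (hasAgg_aggregate W A), fun h =>
    (hasAgg_aggregate W A).congr h (Equiv.refl I) fun i => Ban.Iso.refl (W i)⟩

end aggregate

theorem Ban.Iso.prod {V V' W W' : Ban k} (h : V.Iso V') (h' : W.Iso W') :
    (V.prod W).Iso (V'.prod W') := by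
  obtain ⟨e⟩ := h
  obtain ⟨f⟩ := h'
  refine ⟨⟨LinearEquiv.prodCongr e.toLinearEquiv f.toLinearEquiv, fun v => ?_⟩⟩
  exact congr_arg₂ max (e.norm_map v.1) (f.norm_map v.2)

theorem Ban.iso_prod_comm (V W : Ban k) : (V.prod W).Iso (W.prod V) :=
  ⟨⟨LinearEquiv.prodComm k V W, fun _ => max_comm _ _⟩⟩

theorem Ban.iso_prod_assoc (U V W : Ban k) : ((U.prod V).prod W).Iso (U.prod (V.prod W)) :=
  ⟨⟨LinearEquiv.prodAssoc k U V W, fun _ => (max_assoc _ _ _).symm⟩⟩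

theorem hasAgg_finite_pi [IsUltrametricDist k] [CompleteSpace k] {A : Kind} {V : Ban k} {I : Type v}
    [Finite I] {d : ℕ} (e : I ≃ Fin d) :
    HasAgg A V (fun _ : I => Ban.base k) ↔ Nonempty (V.carrier ≃ₗᵢ[k] (Fin d → k)) := by
  let F : Ban k :=
    { carrier := Fin d → k
      instUltra := IsUltrametricDist.isUltrametricDist_of_forall_norm_add_le_max_norm fun x y => by
        refine (pi_norm_le_iff_of_nonneg (le_max_of_le_left (norm_nonneg _))).2 fun i => ?_
        exact (IsUltrametricDist.norm_add_le_max (x i) (y i)).trans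
          (max_le_max (norm_le_pi_norm x i) (norm_le_pi_norm y i)) }
  have hF : HasAgg A F fun _ : Fin d => Ban.base k :=
    ⟨LinearMap.id, fun v i => norm_le_pi_norm v i, fun v C hC h => (pi_norm_le_iff_of_nonneg hC).2 h,
      fun _ => Adm.of_finite _, fun w _ => ⟨w, rfl⟩⟩
  have hF' : HasAgg A F fun _ : I => Ban.base k :=
    hF.congr (Ban.Iso.refl F) e fun _ => Ban.Iso.refl _
  exact ⟨fun h => h.iso hF', fun h => hF'.congr h (Equiv.refl I) fun _ => Ban.Iso.refl _⟩

/-! ### Chase's lemma -/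

section

variable {I : Type v} {J : Type w} {V : I → Ban k} {W : J → Ban k} {X Y : Ban k}
  {φ : X →ₗ[k] ∀ i, V i} {ψ : Y →ₗ[k] ∀ j, W j}

theorem exists_norm_between (hk : Dense (Set.range fun x : k => ‖x‖₊)) {a b : ℝ} (ha : 0 ≤ a)
    (hab : a < b) : ∃ c : k, a < ‖c‖ ∧ ‖c‖ < b := by
  obtain ⟨r, ⟨c, rfl⟩, hc⟩ := hk.exists_between
    (show (⟨a, ha⟩ : NNReal) < ⟨b, ha.trans hab.le⟩ from hab)
  exact ⟨c, hc⟩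

/-- A map into a completed sum that is not small has almost extremal values. -/
theorem exists_near_optimal (hk : Dense (Set.range fun x : k => ‖x‖₊)) (hY : IsAgg .sigma Y W ψ)
    {f : X →ₗ[k] Y} {C : ℝ} (hf : ∀ x, ‖f x‖ ≤ C * ‖x‖) {ε : ℝ} (hε : 0 < ε) (E : Submodule k X)
    (F : Set J) (h : ∃ x ∈ E, ∃ j ∉ F, ε * ‖x‖ < ‖ψ (f x) j‖) {s b : ℝ} (hs : 0 < s) (hb : s < b) :
    ∃ N, ε ≤ N ∧ (∀ x ∈ E, ∀ j ∉ F, ‖ψ (f x) j‖ ≤ N * ‖x‖) ∧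
      ∃ z ∈ E, ∃ j ∉ F, ‖z‖ ≤ b ∧ s * N < ‖ψ (f z) j‖ := by
  -- `sInf Z` is the operator norm of `f` restricted to `E` and composed with the projection off
  -- `F`.
  set Z := {K : ℝ | 0 ≤ K ∧ ∀ x ∈ E, ∀ j ∉ F, ‖ψ (f x) j‖ ≤ K * ‖x‖}
  have hne : Z.Nonempty := by
    refine ⟨max C 0, le_max_right _ _, fun x _ j _ => (hY.norm_apply_le _ j).trans ?_⟩
    exact (hf x).trans (mul_le_mul_of_nonneg_right (le_max_left _ _) (norm_nonneg _))
  have hbdd : BddBelow Z := ⟨0, fun K hK => hK.1⟩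
  have hεN : ε ≤ sInf Z := by
    refine le_csInf hne fun K hK => ?_
    obtain ⟨x, hx, j, hj, hxj⟩ := h
    exact (lt_of_mul_lt_mul_right (hxj.trans_le (hK.2 x hx j hj)) (norm_nonneg _)).le
  have hvalid : ∀ x ∈ E, ∀ j ∉ F, ‖ψ (f x) j‖ ≤ sInf Z * ‖x‖ := by
    intro x hx j hj
    rcases (norm_nonneg x).eq_or_lt with h0 | h0
    · obtain rfl : x = 0 := norm_eq_zero.1 h0.symm
      simp
    · rw [← div_le_iff₀ h0]
      exact le_csInf hne fun K hK => (div_le_iff₀ h0).2 (hK.2 x hx j hj)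
  refine ⟨sInf Z, hεN, hvalid, ?_⟩
  have hN : 0 < sInf Z := hε.trans_le hεN
  -- Since `s / t < 1`, the constant `s / t * sInf Z` is not a bound, so some `x` violates it; by
  -- density of the value set, `x` can be rescaled to norm between `t` and `b`, and the factor `t`
  -- cancels.
  obtain ⟨t, hst, htb⟩ := exists_between hb
  have ht : 0 < t := hs.trans hst
  have hθ : s / t * sInf Z < sInf Z := by
    have : s / t < 1 := (div_lt_one ht).2 hst
    nlinarith
  have hnot := notMem_of_lt_csInf hθ hbdd
  have hθ0 : 0 ≤ s / t * sInf Z := by positivity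
  obtain ⟨x, hx, j, hj, hxj⟩ : ∃ x ∈ E, ∃ j ∉ F, s / t * sInf Z * ‖x‖ < ‖ψ (f x) j‖ := by
    by_contra! hcon
    exact hnot ⟨hθ0, hcon⟩
  have hx0 : 0 < ‖x‖ := by
    refine norm_pos_iff.2 ?_
    rintro rfl
    simp at hxj
  obtain ⟨c, hc1, hc2⟩ := exists_norm_between hk (a := t / ‖x‖) (b := b / ‖x‖) (by positivity)
    (by gcongr)
  rw [div_lt_iff₀ hx0] at hc1
  rw [lt_div_iff₀ hx0] at hc2
  refine ⟨c • x, E.smul_mem c hx, j, hj, by rw [norm_smul]; exact hc2.le, ?_⟩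
  have hc0 : 0 < ‖c‖ := by
    by_contra h0
    nlinarith
  calc s * sInf Z = t * (s / t * sInf Z) := by field_simp
    _ ≤ ‖c‖ * ‖x‖ * (s / t * sInf Z) := mul_le_mul_of_nonneg_right hc1.le hθ0
    _ = ‖c‖ * (s / t * sInf Z * ‖x‖) := by ring
    _ < ‖c‖ * ‖ψ (f x) j‖ := mul_lt_mul_of_pos_left hxj hc0
    _ = ‖ψ (f (c • x)) j‖ := by simp [norm_smul]

/-- The members of an aggregate with support in `S`. -/
def suppSub (φ : X →ₗ[k] ∀ i, V i) (S : Set I) : Submodule k X where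
  carrier := {x | ∀ i ∉ S, φ x i = 0}
  zero_mem' := fun i _ => by simp
  add_mem' := fun hx hy i hi => by simp [hx i hi, hy i hi]
  smul_mem' := fun c x hx i hi => by simp [hx i hi]

theorem suppSub_mono {S T : Set I} (h : S ⊆ T) : suppSub φ S ≤ suppSub φ T :=
  fun _ hx i hi => hx i fun h' => hi (h h')

/-- The sums of the tails of a sequence in a bounded product whose supports shrink to `∅`. -/
theorem exists_tail_sums (hX : IsAgg .pi X V φ) {S : ℕ → Set I} (hS : Antitone S)
    (hS0 : ⋂ n, S n = ∅) {z : ℕ → X} (hz : ∀ n, z n ∈ suppSub φ (S n)) {b : ℕ → ℝ}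
    (hb : Antitone b) (hzb : ∀ n, ‖z n‖ ≤ b n) :
    ∃ y : ℕ → X, ∀ n, y n ∈ suppSub φ (S n) ∧ ‖y n‖ ≤ b n ∧ y n = z n + y (n + 1) := by
  have hM : ∀ i, ∃ m, i ∉ S m := by
    intro i
    by_contra! hcon
    exact (Set.mem_empty_iff_false i).1 (hS0 ▸ Set.mem_iInter.2 hcon)
  -- Coordinate `i` has left the supports from index `M i` on, so the infinite tail sum is finite in
  -- each coordinate.
  choose M hM using hM
  have hb0 : ∀ n, 0 ≤ b n := fun n => (norm_nonneg _).trans (hzb n)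
  have hle : ∀ n i, ‖∑ m ∈ Finset.Ico n (M i), φ (z m) i‖ ≤ b n := by
    intro n i
    refine IsUltrametricDist.norm_sum_le_of_forall_le_of_nonneg (hb0 n) fun m hm => ?_
    exact (hX.norm_apply_le _ i).trans ((hzb m).trans (hb (Finset.mem_Ico.1 hm).1))
  have hy : ∀ n, ∃ y, φ y = fun i => ∑ m ∈ Finset.Ico n (M i), φ (z m) i := fun n =>
    hX.exists_of_adm _ ⟨b n, hle n⟩
  choose y hy using hy
  refine ⟨y, fun n => ⟨fun i hi => ?_, ?_, hX.injective <| funext fun i => ?_⟩⟩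
  · rw [hy]
    exact Finset.sum_eq_zero fun m hm => hz m i fun h => hi (hS (Finset.mem_Ico.1 hm).1 h)
  · exact hX.norm_le _ _ (hb0 n) fun i => by rw [hy]; exact hle n i
  · rw [map_add, Pi.add_apply, hy, hy]
    rcases lt_or_ge n (M i) with h | h
    · exact Finset.sum_eq_sum_Ico_succ_bot h _
    · beta_reduce
      rw [Finset.Ico_eq_empty_of_le h, Finset.Ico_eq_empty_of_le (h.trans n.le_succ),
        hz n i fun h' => hM i (hS h h')]
      simp

/-- A bounded linear map from a bounded product to a completed sum is small on some member of
every sequence of subproducts whose supports shrink to `∅`, up to finitely many coordinates. -/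
theorem exists_small_of_antitone (hk : Dense (Set.range fun x : k => ‖x‖₊))
    (hX : IsAgg .pi X V φ) (hY : IsAgg .sigma Y W ψ)
    {f : X →ₗ[k] Y} {C : ℝ} (hf : ∀ x, ‖f x‖ ≤ C * ‖x‖) {ε : ℝ} (hε : 0 < ε)
    {S : ℕ → Set I} (hS : Antitone S) (hS0 : ⋂ n, S n = ∅) :
    ∃ n, ∃ F : Finset J, ∀ x ∈ suppSub φ (S n), ∀ j ∉ F, ‖ψ (f x) j‖ ≤ ε * ‖x‖ := by
  classical
  by_contra! hcon
  -- Gliding hump: the bounds decrease strictly, so `z n` may have norm up to `b n` while all later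
  -- terms stay within `b (n + 1)`. This gap lets the image of `z n` beat the tail.
  let b : ℕ → ℝ := fun n => 1 + 1 / (n + 1)
  have hb1 : ∀ n, 1 < b n := fun n => by
    have : (0 : ℝ) < 1 / (n + 1) := by positivity
    simp only [b]; linarith
  have hbs : StrictAnti b := strictAnti_nat_of_succ_lt fun n => by
    have : (1 : ℝ) / ((n + 1 : ℕ) + 1) < 1 / (n + 1) := by
      apply one_div_lt_one_div_of_lt <;> push_cast <;> linarith [n.cast_nonneg (α := ℝ)]
    simp only [b]; linarith
  have step : ∀ n (F : Finset J), ∃ N, ε ≤ N ∧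
      (∀ x ∈ suppSub φ (S n), ∀ j ∉ F, ‖ψ (f x) j‖ ≤ N * ‖x‖) ∧
      ∃ z ∈ suppSub φ (S n), ∃ j ∉ F, ‖z‖ ≤ b n ∧ b (n + 1) * N < ‖ψ (f z) j‖ := fun n F =>
    exists_near_optimal hk hY hf hε (suppSub φ (S n)) F (hcon n F)
      (one_pos.trans (hb1 (n + 1))) (hbs n.lt_succ_self)
  choose N hN hval z hz j hj hzb hzj using step
  -- `F n` collects the coordinates chosen before stage `n` and those where an earlier `f (z m)` has
  -- norm at least `ε`.
  let F : ℕ → Finset J := fun n => Nat.rec ∅ (fun n F =>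
    F ∪ ({j n F} ∪ (hY.adm (f (z n F)) ε hε).toFinset)) n
  have hF : ∀ n, F (n + 1) = F n ∪ ({j n (F n)} ∪ (hY.adm (f (z n (F n))) ε hε).toFinset) :=
    fun n => rfl
  have hFm : Monotone F := monotone_nat_of_le_succ fun n => by
    rw [hF]; exact Finset.subset_union_left
  obtain ⟨y, hy⟩ := exists_tail_sums hX hS hS0 (fun n => hz n (F n)) hbs.antitone
    fun n => hzb n (F n)
  have hy0 : ∀ n, y 0 = ∑ m ∈ Finset.range n, z m (F m) + y n := by
    intro n
    induction n with
    | zero => simp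
    | succ n ih => rw [ih, Finset.sum_range_succ, (hy n).2.2, add_assoc]
  -- At the coordinate chosen at stage `n`, the image of `z n` dominates: it exceeds `ε`, the
  -- earlier terms are at most `ε` because the coordinate avoids `F n`, and the tail is at most `b
  -- (n + 1) * N`. The tail is handled as one vector since `f` need not commute with coordinatewise
  -- infinite sums.
  have hlow : ∀ n, ε ≤ ‖ψ (f (y 0)) (j n (F n))‖ := by
    intro n
    set p := j n (F n)
    set u := ∑ m ∈ Finset.range n, ψ (f (z m (F m))) p with hu
    set v := ψ (f (y (n + 1))) p with hv
    have hdec : ψ (f (y 0)) p = u + (ψ (f (z n (F n))) p + v) := by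
      rw [hy0 n, (hy n).2.2]
      simp [hu, hv]
    have h0 : ε < ‖ψ (f (z n (F n))) p‖ := by
      refine lt_of_le_of_lt ?_ (hzj n (F n))
      nlinarith [hN n (F n), hb1 (n + 1)]
    have h1 : ‖u‖ ≤ ε := by
      refine IsUltrametricDist.norm_sum_le_of_forall_le_of_nonneg hε.le fun m hm => ?_
      by_contra hcon
      refine hj n (F n) (hFm (Finset.mem_range.1 hm : m + 1 ≤ n) ?_)
      rw [hF]
      refine Finset.mem_union_right _ (Finset.mem_union_right _ ?_)
      exact (Set.Finite.mem_toFinset _).2 (not_le.1 hcon).le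
    have h2 : ‖v‖ ≤ b (n + 1) * N n (F n) := by
      rw [mul_comm]
      refine (hval n (F n) _ (suppSub_mono (hS n.le_succ) (hy (n + 1)).1) p (hj n (F n))).trans ?_
      exact mul_le_mul_of_nonneg_left (hy (n + 1)).2.1 (hε.le.trans (hN n (F n)))
    have h3 : ‖ψ (f (z n (F n))) p‖ ≤ max ‖ψ (f (y 0)) p‖ (max ‖u‖ ‖v‖) := by
      have : ψ (f (z n (F n))) p = ψ (f (y 0)) p + -(u + v) := by rw [hdec]; abel
      rw [this]
      refine (IsUltrametricDist.norm_add_le_max _ _).trans (max_le_max le_rfl ?_)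
      rw [norm_neg]
      exact IsUltrametricDist.norm_add_le_max _ _
    have h4 := hzj n (F n)
    rcases le_max_iff.1 h3 with h | h
    · linarith
    · rcases le_max_iff.1 h with h | h <;> linarith
  have hinj : Function.Injective fun n => j n (F n) := by
    intro m n heq
    by_contra hne
    wlog hmn : m < n generalizing m n
    · exact this heq.symm (Ne.symm hne) (lt_of_le_of_ne (not_lt.1 hmn) (Ne.symm hne))
    refine hj n (F n) ?_
    rw [← show j m (F m) = j n (F n) from heq]
    exact hFm (show m + 1 ≤ n from hmn) (by simp [hF])
  exact Set.infinite_range_of_injective hinj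
    ((hY.adm (f (y 0)) ε hε).subset (by rintro _ ⟨n, rfl⟩; exact hlow n))

end

/-- If all countably complete ultrafilters on `I` are principal, an ideal of subsets of `I` that
contains a member of every sequence of sets shrinking to `∅` contains the complement of a finite
set. -/
theorem exists_finset_compl_of_ideal {I : Type v}
    (hI : ∀ U : Ultrafilter I, CountableInterFilter (U : Filter I) → ∃ x, U = pure x)
    {G : Set I → Prop} (mono : ∀ {S T}, S ⊆ T → G T → G S)
    (union : ∀ {S T}, G S → G T → G (S ∪ T))
    (seq : ∀ S : ℕ → Set I, Antitone S → ⋂ n, S n = ∅ → ∃ n, G (S n)) :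
    ∃ F : Finset I, G (F : Set I)ᶜ := by
  classical
  by_contra! hcon
  have hempty : G ∅ := (seq (fun _ => ∅) antitone_const (Set.iInter_const _)).elim fun _ h => h
  let L : Filter I :=
    { sets := {S | G Sᶜ}
      univ_sets := show G Set.univᶜ by rwa [Set.compl_univ]
      sets_of_superset := fun hS h => mono (Set.compl_subset_compl.2 h) hS
      inter_sets := fun {S T} hS hT => by
        have := union hS hT
        rwa [← Set.compl_inter] at this }
  -- If no cofinite set lies in the ideal, the dual filter is compatible with the cofinite filter;
  -- an ultrafilter above both is non-principal and avoids `G`.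
  have hne : (L ⊓ Filter.cofinite).NeBot := by
    refine Filter.inf_neBot_iff.2 fun {S} hS {T} hT => ?_
    by_contra hST
    rw [Set.not_nonempty_iff_eq_empty] at hST
    refine hcon (Filter.mem_cofinite.1 hT).toFinset (mono ?_ (show G Sᶜ from hS))
    intro i hi hiS
    refine hi ?_
    simp only [Set.Finite.coe_toFinset]
    exact fun hiT => (Set.mem_empty_iff_false i).1 (hST ▸ ⟨hiS, hiT⟩)
  obtain ⟨U, hU⟩ := Ultrafilter.exists_le (L ⊓ Filter.cofinite)
  have hUG : ∀ S ∈ U, ¬ G S := fun S hS hG => by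
    have : Sᶜ ∈ U := hU.trans inf_le_left (show G Sᶜᶜ by rwa [compl_compl])
    exact Ultrafilter.compl_notMem_iff.2 hS this
  have hUc : CountableInterFilter (U : Filter I) := by
    refine ⟨fun S hSc hS => ?_⟩
    by_contra hnot
    rcases S.eq_empty_or_nonempty with rfl | hSne
    · exact hnot (by simp)
    obtain ⟨s, rfl⟩ := hSc.exists_eq_range hSne
    -- A failure of countable completeness gives members of `U` that decrease to `∅`, one of which
    -- would lie in `G`.
    have hT : ∀ n, (⋂ m ∈ Set.Iic n, s m) ∩ (⋂₀ Set.range s)ᶜ ∈ U := fun n =>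
      Filter.inter_mem ((Filter.biInter_mem (Set.finite_Iic n)).2 fun m _ => hS _ ⟨m, rfl⟩)
        (Ultrafilter.compl_mem_iff_notMem.2 hnot)
    obtain ⟨n, hn⟩ := seq (fun n => (⋂ m ∈ Set.Iic n, s m) ∩ (⋂₀ Set.range s)ᶜ)
      (fun a b hab => Set.inter_subset_inter_left _
        (Set.biInter_subset_biInter_left (Set.Iic_subset_Iic.2 hab))) (by
        refine Set.eq_empty_of_forall_notMem fun i hi => ?_
        rw [Set.mem_iInter] at hi
        refine (hi 0).2 ?_
        rintro _ ⟨m, rfl⟩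
        exact Set.mem_iInter₂.1 (hi m).1 m (Set.mem_Iic.2 le_rfl))
    exact hUG _ (hT n) hn
  obtain ⟨x, rfl⟩ := hI U hUc
  have : ({x} : Set I)ᶜ ∈ (pure x : Ultrafilter I) :=
    hU.trans inf_le_right (Set.finite_singleton x).compl_mem_cofinite
  exact Ultrafilter.mem_pure.1 this rfl

section

variable {I : Type v} {J : Type w} {V : I → Ban k} {W : J → Ban k} {X Y : Ban k}
  {φ : X →ₗ[k] ∀ i, V i} {ψ : Y →ₗ[k] ∀ j, W j}

open Classical in
/-- The truncation of the members of an aggregate to the coordinates in `S`. -/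
def IsAgg.trunc {A : Kind} (h : IsAgg A X V φ) (S : Set I) : X →ₗ[k] X :=
  h.lift (LinearMap.pi fun i => if i ∈ S then LinearMap.proj i ∘ₗ φ else 0) fun x =>
    (h.adm x).mono fun i => by
      rw [LinearMap.pi_apply]
      split_ifs <;> simp

theorem IsAgg.trunc_apply_of_mem {A : Kind} (h : IsAgg A X V φ) {S : Set I} (x : X) {i : I}
    (hi : i ∈ S) : φ (h.trunc S x) i = φ x i := by
  simp [IsAgg.trunc, hi]

theorem IsAgg.trunc_apply_of_notMem {A : Kind} (h : IsAgg A X V φ) {S : Set I} (x : X) {i : I}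
    (hi : i ∉ S) : φ (h.trunc S x) i = 0 := by
  simp [IsAgg.trunc, hi]

theorem IsAgg.norm_trunc_le {A : Kind} (h : IsAgg A X V φ) (S : Set I) (x : X) :
    ‖h.trunc S x‖ ≤ ‖x‖ := by
  refine h.norm_le _ _ (norm_nonneg x) fun i => ?_
  by_cases hi : i ∈ S
  · rw [h.trunc_apply_of_mem x hi]
    exact h.norm_apply_le x i
  · simp [h.trunc_apply_of_notMem x hi]

/-- **Chase's lemma** for bounded linear maps from a bounded product to a completed sum. -/
theorem exists_small_off_finset (hk : Dense (Set.range fun x : k => ‖x‖₊))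
    (hI : ∀ U : Ultrafilter I, CountableInterFilter (U : Filter I) → ∃ x, U = pure x)
    (hX : IsAgg .pi X V φ) (hY : IsAgg .sigma Y W ψ)
    {f : X →ₗ[k] Y} {C : ℝ} (hf : ∀ x, ‖f x‖ ≤ C * ‖x‖) {ε : ℝ} (hε : 0 < ε) :
    ∃ (D : Finset I) (F : Finset J), ∀ x, (∀ i ∈ D, φ x i = 0) → ∀ j ∉ F,
      ‖ψ (f x) j‖ ≤ ε * ‖x‖ := by
  classical
  obtain ⟨D, F, hF⟩ := exists_finset_compl_of_ideal hI
    (G := fun S => ∃ F : Finset J, ∀ x ∈ suppSub φ S, ∀ j ∉ F, ‖ψ (f x) j‖ ≤ ε * ‖x‖)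
    (fun h ⟨F, hF⟩ => ⟨F, fun x hx => hF x (suppSub_mono h hx)⟩)
    (fun {S T} ⟨F, hF⟩ ⟨F', hF'⟩ => by
      refine ⟨F ∪ F', fun x hx j hj => ?_⟩
      rw [Finset.mem_union, not_or] at hj
      -- Supports in a union split into two truncations; the ultrametric inequality keeps the same
      -- `ε`, so these sets form an ideal.
      have hdec : x = hX.trunc S x + hX.trunc Sᶜ x := hX.injective <| funext fun i => by
        rw [map_add, Pi.add_apply]
        by_cases hi : i ∈ S
        · rw [hX.trunc_apply_of_mem x hi, hX.trunc_apply_of_notMem x (by simpa), add_zero]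
        · rw [hX.trunc_apply_of_notMem x hi, hX.trunc_apply_of_mem x (by simpa), zero_add]
      have h1 := hF (hX.trunc S x) (fun i hi => hX.trunc_apply_of_notMem x hi) j hj.1
      have h2 := hF' (hX.trunc Sᶜ x) (fun i hi => by
        by_cases hS : i ∈ S
        · exact hX.trunc_apply_of_notMem x (by simpa)
        · rw [hX.trunc_apply_of_mem x hS]
          exact hx i (by simp [hS, hi])) j hj.2
      calc ‖ψ (f x) j‖ = ‖ψ (f (hX.trunc S x)) j + ψ (f (hX.trunc Sᶜ x)) j‖ := by
            conv_lhs => rw [hdec]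
            simp
        _ ≤ max _ _ := IsUltrametricDist.norm_add_le_max _ _
        _ ≤ ε * ‖x‖ := max_le (h1.trans (mul_le_mul_of_nonneg_left (hX.norm_trunc_le _ x) hε.le))
          (h2.trans (mul_le_mul_of_nonneg_left (hX.norm_trunc_le _ x) hε.le)))
    (fun S hS hS0 => exists_small_of_antitone hk hX hY hf hε hS hS0)
  exact ⟨D, F, fun x hx j hj => hF x (fun i hi => hx i (by simpa using hi)) j hj⟩

end

/-! ### Approximate direct summands -/

/-- The first projection of a product. -/
def Ban.fst (X Y : Ban k) : X.prod Y →ₗ[k] X := LinearMap.fst k X Y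

/-- The inclusion of the first factor in a product. -/
def Ban.inl (X Y : Ban k) : X →ₗ[k] X.prod Y := LinearMap.inl k X Y

/-- The map of products induced by a map of the first factors. -/
def Ban.mapFst {X X' : Ban k} (f : X →ₗ[k] X') (Y : Ban k) : X.prod Y →ₗ[k] X'.prod Y :=
  LinearMap.prodMap f LinearMap.id

theorem Ban.norm_fst_le {X Y : Ban k} (x : X.prod Y) : ‖Ban.fst X Y x‖ ≤ ‖x‖ := le_max_left _ _

theorem Ban.norm_inl (X Y : Ban k) (x : X) : ‖Ban.inl X Y x‖ = ‖x‖ :=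
  max_eq_left ((norm_zero (E := Y)).trans_le (norm_nonneg x))

theorem Ban.norm_mapFst_le {X X' Y : Ban k} {f : X →ₗ[k] X'} (hf : ∀ x, ‖f x‖ ≤ ‖x‖)
    (x : X.prod Y) : ‖Ban.mapFst f Y x‖ ≤ ‖x‖ :=
  max_le_max (hf _) le_rfl

/-- `X` is a direct summand of `Y` up to a small perturbation. -/
def AppRetract (X Y : Ban k) : Prop :=
  ∃ (i : X →ₗ[k] Y) (r : Y →ₗ[k] X) (C q : ℝ), 0 ≤ C ∧ q < 1 ∧ (∀ x, ‖i x‖ ≤ C * ‖x‖) ∧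
    (∀ y, ‖r y‖ ≤ C * ‖y‖) ∧ ∀ x, ‖r (i x) - x‖ ≤ q * ‖x‖

/-- `X` is an orthogonal direct summand of `Y`. -/
def Summand (X Y : Ban k) : Prop :=
  ∃ (i : X →ₗ[k] Y) (r : Y →ₗ[k] X), (∀ x, ‖i x‖ ≤ ‖x‖) ∧ (∀ y, ‖r y‖ ≤ ‖y‖) ∧ ∀ x, r (i x) = x

theorem Ban.Iso.summand {X Y : Ban k} (h : X.Iso Y) : Summand X Y := by
  obtain ⟨e⟩ := h
  exact ⟨e.toLinearEquiv, e.symm.toLinearEquiv, fun x => (e.norm_map x).le,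
    fun y => (e.symm.norm_map y).le, fun x => e.symm_apply_apply x⟩

theorem Summand.prod_left (X Y : Ban k) : Summand X (X.prod Y) :=
  ⟨Ban.inl X Y, Ban.fst X Y, fun x => (Ban.norm_inl X Y x).le, Ban.norm_fst_le, fun _ => rfl⟩

theorem Summand.appRetract {X Y : Ban k} (h : Summand X Y) : AppRetract X Y := by
  obtain ⟨i, r, hi, hr, h⟩ := h
  exact ⟨i, r, 1, 0, one_pos.le, one_pos, by simpa using hi, by simpa using hr, by simp [h]⟩

theorem Summand.trans_appRetract {X Y Z : Ban k} (h : Summand X Y) (h' : AppRetract Y Z) :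
    AppRetract X Z := by
  obtain ⟨i, r, hi, hr, h⟩ := h
  obtain ⟨i', r', C, q, hC, hq, hi', hr', h'⟩ := h'
  -- `q` may be negative, and then `‖i x‖ ≤ ‖x‖` could not be multiplied by it.
  refine ⟨i' ∘ₗ i, r ∘ₗ r', C, max q 0, hC, max_lt hq one_pos, fun x => ?_, fun y => ?_, fun x => ?_⟩
  · exact (hi' _).trans (mul_le_mul_of_nonneg_left (hi x) hC)
  · exact (hr _).trans (hr' y)
  · calc ‖r (r' (i' (i x))) - x‖ = ‖r (r' (i' (i x)) - i x)‖ := by rw [map_sub, h]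
      _ ≤ ‖r' (i' (i x)) - i x‖ := hr _
      _ ≤ q * ‖i x‖ := h' _
      _ ≤ max q 0 * ‖i x‖ := mul_le_mul_of_nonneg_right (le_max_left _ _) (norm_nonneg _)
      _ ≤ max q 0 * ‖x‖ := mul_le_mul_of_nonneg_left (hi x) (le_max_right _ _)

theorem AppRetract.trans_summand {X Y Z : Ban k} (h : AppRetract X Y) (h' : Summand Y Z) :
    AppRetract X Z := by
  obtain ⟨i, r, C, q, hC, hq, hi, hr, h⟩ := h
  obtain ⟨i', r', hi', hr', h'⟩ := h'
  refine ⟨i' ∘ₗ i, r ∘ₗ r', C, q, hC, hq, fun x => (hi' _).trans (hi x), fun y => ?_, fun x => ?_⟩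
  · exact (hr _).trans (mul_le_mul_of_nonneg_left (hr' y) hC)
  · simpa [h'] using h x

theorem AppRetract.exists_injective {X Y : Ban k} (h : AppRetract X Y) :
    ∃ i : X →ₗ[k] Y, Function.Injective i := by
  obtain ⟨i, r, C, q, _, hq, _, _, h⟩ := h
  refine ⟨i, (injective_iff_map_eq_zero i).2 fun x hx => ?_⟩
  have := h x
  rw [hx, map_zero, zero_sub, norm_neg] at this
  exact norm_le_zero_iff.1 (by nlinarith [norm_nonneg x])

section

variable {A : Kind} {I : Type v} {J : Type w} {V : I → Ban k} {W : J → Ban k} {X X' Y Z : Ban k}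
  {φ : X →ₗ[k] ∀ i, V i} {ψ : Z →ₗ[k] ∀ j, W j}

theorem HasAgg.summand (h : HasAgg A X V) (i : I) : Summand (V i) X := by
  classical
  obtain ⟨φ, h⟩ := h
  have hadm : ∀ w : V i, Adm A fun j => ‖LinearMap.single k (fun i => (V i).carrier) i w j‖ :=
    fun w => (Adm.of_finite (A := A) fun _ : Unit => ‖w‖).extend (e := fun _ => i) (by simp)
      fun j hj => by
        have : j ≠ i := fun h => hj ⟨(), h.symm⟩
        simp [this]
  refine ⟨h.lift (LinearMap.single k (fun i => (V i).carrier) i) hadm, LinearMap.proj i ∘ₗ φ,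
    fun x => h.norm_le _ _ (norm_nonneg x) fun j => ?_, fun y => h.norm_apply_le y i, fun x => ?_⟩
  · rw [h.apply_lift]
    rcases eq_or_ne j i with rfl | hj
    · simp
    · simp [hj]
  · simp

/-- The restriction of the members of an aggregate to a set of coordinates, and the extension by
zero. -/
theorem IsAgg.exists_res_ext (h : IsAgg A X V φ) (S : Set I) {φ' : X' →ₗ[k] ∀ i : S, V i}
    (h' : IsAgg A X' (fun i : S => V i) φ') :
    ∃ (res : X →ₗ[k] X') (ext : X' →ₗ[k] X), (∀ x, ‖res x‖ ≤ ‖x‖) ∧ (∀ x, ‖ext x‖ ≤ ‖x‖) ∧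
      (∀ x i, φ' (res x) i = φ x i) ∧ (∀ x (i : S), φ (ext x) i = φ' x i) ∧
      ∀ x, ∀ i ∉ S, φ (ext x) i = 0 := by
  classical
  have hres : ∀ x, Adm A fun i : S => ‖LinearMap.pi (fun i : S => LinearMap.proj i.1 ∘ₗ φ) x i‖ :=
    fun x => (h.adm x).comp (e := Subtype.val) Subtype.val_injective
  let g : X' →ₗ[k] ∀ i, V i :=
    LinearMap.pi fun i => if hi : i ∈ S then LinearMap.proj (⟨i, hi⟩ : S) ∘ₗ φ' else 0
  have hg : ∀ x (i : S), g x i = φ' x i := fun x i => by simp [g]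
  have hg0 : ∀ x, ∀ i ∉ S, g x i = 0 := fun x i hi => by simp [g, hi]
  have hext : ∀ x, Adm A fun i => ‖g x i‖ := fun x =>
    (h'.adm x).extend (e := Subtype.val) (fun i => by rw [hg]) fun i hi => by
      rw [hg0 x i (by simpa using hi), norm_zero]
  refine ⟨h'.lift _ hres, h.lift g hext, fun x => ?_, fun x => ?_, fun x i => ?_, fun x i => ?_,
    fun x i hi => ?_⟩
  · refine h'.norm_le _ _ (norm_nonneg x) fun i => ?_
    rw [h'.apply_lift]
    exact h.norm_apply_le x i
  · refine h.norm_le _ _ (norm_nonneg x) fun i => ?_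
    rw [h.apply_lift]
    by_cases hi : i ∈ S
    · rw [hg x ⟨i, hi⟩]
      exact h'.norm_apply_le x _
    · simp [hg0 x i hi]
  · simp
  · rw [h.apply_lift, hg]
  · rw [h.apply_lift, hg0 x i hi]

/-- Chase's lemma applies to whichever map goes from the product to the sum: to `i` if `X` is the
product, to `r` if `Z` is. In both cases the part of `r ∘ i` that passes through the coordinates off
`F` becomes small off `D`. -/
theorem exists_small_factor (hk : Dense (Set.range fun x : k => ‖x‖₊))
    (hI : ∀ U : Ultrafilter I, CountableInterFilter (U : Filter I) → ∃ x, U = pure x)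
    (hJ : ∀ U : Ultrafilter J, CountableInterFilter (U : Filter J) → ∃ x, U = pure x)
    (hX : IsAgg A X V φ) (hZ : IsAgg A.dual Z W ψ) {i : X →ₗ[k] Z} {r : Z →ₗ[k] X} {C : ℝ}
    (hC : 0 ≤ C) (hi : ∀ x, ‖i x‖ ≤ C * ‖x‖) (hr : ∀ z, ‖r z‖ ≤ C * ‖z‖) {ε : ℝ} (hε : 0 < ε) :
    ∃ (D : Finset I) (F : Finset J), ∀ x, (∀ j ∈ D, φ x j = 0) → ∀ j ∉ D,
      ‖φ (r (hZ.trunc (F : Set J)ᶜ (i x))) j‖ ≤ C * ε * ‖x‖ := by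
  cases A with
  | pi =>
    obtain ⟨D, F, h⟩ := exists_small_off_finset hk hI hX hZ hi hε
    refine ⟨D, F, fun x hx j _ => (hX.norm_apply_le _ j).trans ((hr _).trans ?_)⟩
    rw [mul_assoc]
    refine mul_le_mul_of_nonneg_left (hZ.norm_le _ _ (by positivity) fun l => ?_) hC
    by_cases hl : l ∈ F
    · rw [hZ.trunc_apply_of_notMem _ (by simpa using hl), norm_zero]
      positivity
    · rw [hZ.trunc_apply_of_mem _ (by simpa using hl)]
      exact h x hx l hl
  | sigma =>
    obtain ⟨F, D, h⟩ := exists_small_off_finset hk hJ hZ hX hr hε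
    refine ⟨D, F, fun x _ j hj => ?_⟩
    calc _ ≤ ε * ‖hZ.trunc (F : Set J)ᶜ (i x)‖ :=
          h _ (fun l hl => hZ.trunc_apply_of_notMem _ (by simpa using hl)) j hj
      _ ≤ ε * (C * ‖x‖) := mul_le_mul_of_nonneg_left ((hZ.norm_trunc_le _ _).trans (hi x)) hε.le
      _ = C * ε * ‖x‖ := by ring

end

/-- If an aggregate is a summand of a product of `Y` and of an aggregate of the other kind, up to a
small perturbation, then up to finitely many coordinates it is a summand of the product of `Y` and
of a finite part of the other aggregate. -/
theorem AppRetract.exists_finset (hk : Dense (Set.range fun x : k => ‖x‖₊)) {A : Kind}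
    {I J : Type u} {V : I → Ban k} {W : J → Ban k} {X Y Z : Ban k}
    (hI : ∀ U : Ultrafilter I, CountableInterFilter (U : Filter I) → ∃ x, U = pure x)
    (hJ : ∀ U : Ultrafilter J, CountableInterFilter (U : Filter J) → ∃ x, U = pure x)
    (hX : HasAgg A X V) (hZ : HasAgg A.dual Z W) (h : AppRetract X (Z.prod Y)) :
    ∃ (D : Finset I) (F : Finset J),
      AppRetract (aggregate A fun i : ((D : Set I)ᶜ : Set I) => V i)
        ((aggregate A.dual fun j : (F : Set J) => W j).prod Y) := by
  obtain ⟨φ, hX⟩ := hX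
  obtain ⟨ψ, hZ⟩ := hZ
  obtain ⟨i, r, C, q, hC, hq, hi, hr, h⟩ := h
  -- With this `ε` the new error `C * ε` is at most `1 / 2`.
  obtain ⟨D, F, hDF⟩ := exists_small_factor hk hI hJ hX hZ (i := Ban.fst Z Y ∘ₗ i)
    (r := r ∘ₗ Ban.inl Z Y) hC (fun x => (Ban.norm_fst_le _).trans (hi x))
    (fun z => (hr _).trans (mul_le_mul_of_nonneg_left (Ban.norm_inl Z Y z).le hC))
    (ε := 1 / (2 * (C + 1))) (by positivity)
  refine ⟨D, F, ?_⟩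
  obtain ⟨φ', hX'⟩ := hasAgg_aggregate (fun i : ((D : Set I)ᶜ : Set I) => V i) A
  obtain ⟨ψ', hZ'⟩ := hasAgg_aggregate (fun j : (F : Set J) => W j) A.dual
  obtain ⟨res, ext, hres, hext, hres', hext', hext0⟩ := hX.exists_res_ext _ hX'
  obtain ⟨resZ, extZ, hresZ, hextZ, hresZ', hextZ', hextZ0⟩ := hZ.exists_res_ext _ hZ'
  generalize (aggregate A fun i : ((D : Set I)ᶜ : Set I) => V i) = X' at *
  generalize (aggregate A.dual fun j : (F : Set J) => W j) = Z' at *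
  have hdec : ∀ z, extZ (resZ z) = z - hZ.trunc (F : Set J)ᶜ z := fun z =>
    hZ.injective <| funext fun j => by
      rw [map_sub, Pi.sub_apply]
      by_cases hj : j ∈ (F : Set J)
      · rw [hextZ' _ ⟨j, hj⟩, hresZ', hZ.trunc_apply_of_notMem z (by simpa using hj), sub_zero]
      · rw [hextZ0 _ j hj, hZ.trunc_apply_of_mem z hj, sub_self]
  refine ⟨Ban.mapFst resZ Y ∘ₗ i ∘ₗ ext, res ∘ₗ r ∘ₗ Ban.mapFst extZ Y, C, max q (1 / 2), hC,
    max_lt hq (by norm_num), fun x => ?_, fun y => ?_, fun x => ?_⟩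
  · calc _ ≤ ‖i (ext x)‖ := Ban.norm_mapFst_le hresZ _
      _ ≤ C * ‖ext x‖ := hi _
      _ ≤ C * ‖x‖ := mul_le_mul_of_nonneg_left (hext x) hC
  · exact (hres _).trans ((hr _).trans
      (mul_le_mul_of_nonneg_left (Ban.norm_mapFst_le hextZ _) hC))
  · refine hX'.norm_le _ _ (by positivity) fun j => ?_
    set z := Ban.fst Z Y (i (ext x))
    have h1 : Ban.mapFst extZ Y (Ban.mapFst resZ Y (i (ext x))) =
        i (ext x) - Ban.inl Z Y (hZ.trunc (F : Set J)ᶜ z) :=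
      Prod.ext (hdec _) (sub_zero _).symm
    -- The defect is the old one plus the contribution of the discarded tail of `Z`; its norm is
    -- bounded by the maximum of the two, hence by `max q (1 / 2) < 1`.
    have h2 : φ' (res (r (Ban.mapFst extZ Y (Ban.mapFst resZ Y (i (ext x))))) - x) j =
        φ (r (i (ext x)) - ext x) j + -φ (r (Ban.inl Z Y (hZ.trunc (F : Set J)ᶜ z))) j := by
      rw [map_sub, Pi.sub_apply, hres', h1, ← hext', map_sub, map_sub, map_sub]
      simp only [Pi.sub_apply]
      abel
    have h3 : ‖φ (r (i (ext x)) - ext x) j‖ ≤ max q (1 / 2) * ‖ext x‖ :=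
      (hX.norm_apply_le _ _).trans ((h _).trans
        (mul_le_mul_of_nonneg_right (le_max_left _ _) (norm_nonneg _)))
    have h4 : ‖φ (r (Ban.inl Z Y (hZ.trunc (F : Set J)ᶜ z))) j‖ ≤
        max q (1 / 2) * ‖ext x‖ := by
      refine (hDF (ext x) (fun l hl => hext0 x l (by simpa using hl)) j j.2).trans ?_
      refine mul_le_mul_of_nonneg_right (le_max_of_le_right ?_) (norm_nonneg _)
      rw [mul_one_div, div_le_div_iff₀ (by positivity) (by positivity)]
      linarith
    calc _ ≤ max q (1 / 2) * ‖ext x‖ := by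
          refine (congrArg norm h2).trans_le ((IsUltrametricDist.norm_add_le_max _ _).trans ?_)
          rw [norm_neg]
          exact max_le h3 h4
      _ ≤ max q (1 / 2) * ‖x‖ := mul_le_mul_of_nonneg_left (hext x) (by positivity)

/-- An approximate summand embeds linearly, so `V` is finite-dimensional, whereas nonzero vectors
from distinct components are linearly independent. This is the base case of `not_appRetract`. -/
theorem HasAgg.finite_of_module_finite {A : Kind} {V : Ban k} {I : Type v} {W : I → Ban k}
    (h : HasAgg A V W) {X : Ban k} [Module.Finite k X] (hVX : AppRetract V X) :
    {i | Nontrivial (W i)}.Finite := by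
  classical
  obtain ⟨f, hf⟩ := hVX.exists_injective
  have hfin : Module.Finite k V := Module.Finite.of_injective f hf
  have hw : ∀ i : {i | Nontrivial (W i)}, ∃ w : W i, w ≠ 0 := fun i =>
    haveI : Nontrivial (W i) := i.2
    exists_ne 0
  choose w hw using hw
  obtain ⟨φ, h⟩ := h
  have hv : ∀ i : {i | Nontrivial (W i)}, ∃ v, φ v = Pi.single (i : I) (w i) := fun i =>
    h.exists_of_adm _ <| (Adm.of_finite (A := A) fun _ : Unit => ‖w i‖).extend
      (e := fun _ => (i : I)) (by simp) fun j hj => by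
        have : j ≠ i := fun h => hj ⟨(), h.symm⟩
        simp [this]
  choose v hv using hv
  have hli : LinearIndependent k v := by
    refine linearIndependent_iff'.2 fun s g hg i hi => ?_
    have h1 := congrFun (congrArg φ hg) i
    rw [map_sum, Finset.sum_apply, Finset.sum_eq_single i] at h1
    · simpa [hv, hw] using h1
    · intro j _ hj
      have : (i : I) ≠ j := fun h => hj (Subtype.ext h.symm)
      simp [hv, this]
    · exact fun h => absurd hi h
  exact Set.finite_coe_iff.1 hli.finite_of_isNoetherian

/-! ### Small index sets and ultrafilters -/

section IsSmall

variable {κ : WithTop Cardinal.{u}} {I J : Type u}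

theorem IsSmall.of_injective (h : IsSmall κ I) {f : J → I} (hf : Function.Injective f) :
    IsSmall κ J :=
  lt_of_le_of_lt (WithTop.coe_le_coe.2 (Cardinal.mk_le_of_injective hf)) h

theorem IsSmall.of_finite (hκ : ((ℵ₀ : Cardinal.{u}) : WithTop Cardinal.{u}) ≤ κ) [Finite I] :
    IsSmall κ I :=
  lt_of_lt_of_le (WithTop.coe_lt_coe.2 (Cardinal.lt_aleph0_of_finite I)) hκ

theorem IsSmall.sum (hκ : ((ℵ₀ : Cardinal.{u}) : WithTop Cardinal.{u}) ≤ κ) (hI : IsSmall κ I)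
    (hJ : IsSmall κ J) : IsSmall κ (I ⊕ J) := by
  induction κ using WithTop.recTopCoe with
  | top => exact WithTop.coe_lt_top _
  | coe c =>
    refine WithTop.coe_lt_coe.2 ?_
    rw [Cardinal.mk_sum, Cardinal.lift_id, Cardinal.lift_id]
    exact Cardinal.add_lt_of_lt (WithTop.coe_le_coe.1 hκ) (WithTop.coe_lt_coe.1 hI)
      (WithTop.coe_lt_coe.1 hJ)

/-- The only use of regularity. -/
theorem IsSmall.sigma (hreg : ∀ c : Cardinal.{u}, κ = (c : WithTop Cardinal.{u}) → c.IsRegular)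
    (hI : IsSmall κ I) {J : I → Type u} (hJ : ∀ i, IsSmall κ (J i)) : IsSmall κ (Σ i, J i) := by
  induction κ using WithTop.recTopCoe with
  | top => exact WithTop.coe_lt_top _
  | coe c =>
    refine WithTop.coe_lt_coe.2 ?_
    rw [Cardinal.mk_sigma]
    exact Cardinal.sum_lt_of_isRegular (hreg c rfl) (WithTop.coe_lt_coe.1 hI)
      fun i => WithTop.coe_lt_coe.1 (hJ i)

theorem NonMeasurability.eq_pure (h : NonMeasurability κ) (hI : IsSmall κ I) (U : Ultrafilter I)
    (hU : CountableInterFilter (U : Filter I)) : ∃ x, U = pure x := by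
  by_contra! hcon
  -- Measurable sets are uncountable by definition, so countable sets need a separate argument: the
  -- complements of points would meet in `∅`.
  by_cases hc : Countable I
  · have hx : ∀ x : I, ({x} : Set I)ᶜ ∈ U := fun x => by
      refine Ultrafilter.compl_mem_iff_notMem.2 fun hx => hcon x ?_
      exact Ultrafilter.eq_of_le (by simpa using hx)
    have hempty : (⋂ x : I, ({x} : Set I)ᶜ) ∈ (U : Filter I) := countable_iInter_mem.2 hx
    refine U.neBot.ne (Filter.empty_mem_iff_bot.1 ?_)
    convert hempty
    refine (Set.eq_empty_of_forall_notMem fun x hx => ?_).symm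
    exact Set.mem_iInter.1 hx x rfl
  · exact h I hI ⟨not_countable_iff.1 hc, U, cardinalInterFilter_aleph_one_iff.2 hU, hcon⟩

end IsSmall

/-! ### Splitting aggregates and finite aggregates -/

section HasAgg

variable {A B : Kind} {V : Ban k}

/-- Over a finite index set both admissibility conditions are vacuous, so the two kinds agree. -/
theorem HasAgg.of_finite {I : Type v} [Finite I] {W : I → Ban k} (h : HasAgg A V W) :
    HasAgg B V W := by
  obtain ⟨φ, h⟩ := h
  exact ⟨φ, h.norm_apply_le, h.norm_le, fun _ => Adm.of_finite _,
    fun w _ => h.exists_of_adm w (Adm.of_finite _)⟩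

theorem HasAgg.iso_option {I : Type u} {W : Option I → Ban k} (h : HasAgg A V W) :
    V.Iso ((aggregate A fun i => W (some i)).prod (W none)) :=
  h.iso <| ((hasAgg_aggregate (fun i => W (some i)) A).sum
    (HasAgg.of_unique fun _ : PUnit.{u + 1} => W none)).congr (Ban.Iso.refl _)
      (Equiv.optionEquivSumPUnit I) fun i => by cases i <;> exact Ban.Iso.refl _

theorem HasAgg.iso_subtype {I : Type u} {W : I → Ban k} (h : HasAgg A V W) (p : I → Prop) :
    V.Iso ((aggregate A fun i : {i // p i} => W i).prod (aggregate A fun i : {i // ¬ p i} => W i)) := by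
  classical
  refine h.iso <| ((hasAgg_aggregate (fun i : {i // p i} => W i) A).sum
    (hasAgg_aggregate (fun i : {i // ¬ p i} => W i) A)).congr (Ban.Iso.refl _)
      (Equiv.sumCompl p).symm fun i => ?_
  by_cases hi : p i
  · rw [Equiv.sumCompl_symm_apply_of_pos hi]
    exact Ban.Iso.refl _
  · rw [Equiv.sumCompl_symm_apply_of_neg hi]
    exact Ban.Iso.refl _

variable (k) in
/-- The zero space. -/
def Ban.zero : Ban k := aggregate .pi fun e : PEmpty.{u + 1} => e.elim

theorem hasAgg_zero {I : Type v} [IsEmpty I] (W : I → Ban k) : HasAgg A (Ban.zero k) W :=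
  ((hasAgg_aggregate (fun e : PEmpty.{u + 1} => (e.elim : Ban k)) .pi).of_finite).congr
    (Ban.Iso.refl _) (Equiv.equivOfIsEmpty I PEmpty) isEmptyElim

theorem Ban.iso_prod_zero (V : Ban k) : V.Iso (V.prod (Ban.zero k)) :=
  (HasAgg.of_unique (A := .pi) fun _ : Unit => V).iso <|
    ((HasAgg.of_unique (A := .pi) fun _ : Unit => V).sum
      (hasAgg_zero fun e : PEmpty.{1} => e.elim)).congr (Ban.Iso.refl _)
        (Equiv.sumEmpty Unit PEmpty).symm fun _ => Ban.Iso.refl _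

end HasAgg

/-! ### Levels of the hierarchies and the non-retraction theorem -/

section levels

variable {κ : WithTop Cardinal.{u}} {α β : Ordinal.{u}} {A B : Kind} {V V' : Ban k}

theorem mem_reidLevel_zero : V ∈ reidLevel κ 0 A ↔ V ∈ finiteClass k := by
  rw [reidLevel]
  simp

theorem mem_reidLevel (hα : α ≠ 0) :
    V ∈ reidLevel κ α A ↔ ∃ (I : Type u) (W : I → Ban k), IsSmall κ I ∧
      (∀ i, ∃ β < α, ∃ B : Kind, W i ∈ reidLevel κ β B) ∧ HasAgg A V W := by
  rw [reidLevel]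
  simp [hα, hasAgg_iff_iso]

theorem mem_pureLevel (hα : α ≠ 0) :
    V ∈ pureLevel κ α A ↔ ∃ (I : Type u) (W : I → Ban k), IsSmall κ I ∧
      (∀ i, ∃ β < α, ∃ B : Kind, W i ∈ pureLevel κ β B) ∧
      (∀ β < α, {i | (∃ γ < α, W i ∈ pureLevel κ γ A.dual) ∧
        ¬ ∃ γ < β, W i ∈ pureLevel κ γ A.dual}.Infinite) ∧ HasAgg A V W := by
  rw [pureLevel]
  simp [hα, hasAgg_iff_iso]

theorem finiteClass_iso (h : V.Iso V') (hV : V' ∈ finiteClass k) : V ∈ finiteClass k := by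
  obtain ⟨d, ⟨e⟩⟩ := hV
  exact h.elim fun f => ⟨d, ⟨f.trans e⟩⟩

theorem reidLevel_iso (h : V.Iso V') (hV : V' ∈ reidLevel κ α A) : V ∈ reidLevel κ α A := by
  rcases eq_or_ne α 0 with rfl | hα
  · exact mem_reidLevel_zero.2 (finiteClass_iso h (mem_reidLevel_zero.1 hV))
  · obtain ⟨I, W, hI, hW, hV⟩ := (mem_reidLevel hα).1 hV
    exact (mem_reidLevel hα).2 ⟨I, W, hI, hW, hV.congr h (Equiv.refl I) fun _ => Ban.Iso.refl _⟩

variable [IsUltrametricDist k] [CompleteSpace k]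

theorem mem_finiteClass_iff (A : Kind) :
    V ∈ finiteClass k ↔ ∃ d : ℕ, HasAgg A V fun _ : Fin d => Ban.base k :=
  exists_congr fun d => (hasAgg_finite_pi (Equiv.refl (Fin d))).symm

theorem mem_finiteClass_of_hasAgg {I : Type v} [Finite I]
    (h : HasAgg A V fun _ : I => Ban.base k) : V ∈ finiteClass k := by
  obtain ⟨d, ⟨e⟩⟩ := Finite.exists_equiv_fin I
  exact ⟨d, (hasAgg_finite_pi e).1 h⟩

theorem mem_pureLevel_zero : V ∈ pureLevel κ 0 A ↔ V.Iso (Ban.base k) := by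
  rw [pureLevel]
  simp only [true_and, ne_eq, not_true_eq_false, false_and, or_false]
  exact Iff.rfl

theorem pureLevel_iso (h : V.Iso V') (hV : V' ∈ pureLevel κ α A) : V ∈ pureLevel κ α A := by
  rcases eq_or_ne α 0 with rfl | hα
  · exact mem_pureLevel_zero.2 (h.trans (mem_pureLevel_zero.1 hV))
  · obtain ⟨I, W, hI, hW, hinf, hV⟩ := (mem_pureLevel hα).1 hV
    exact (mem_pureLevel hα).2
      ⟨I, W, hI, hW, hinf, hV.congr h (Equiv.refl I) fun _ => Ban.Iso.refl _⟩

theorem base_mem_finiteClass : Ban.base k ∈ finiteClass k :=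
  mem_finiteClass_of_hasAgg (HasAgg.of_unique (A := .pi) fun _ : Unit => Ban.base k)

theorem pureLevel_subset_reidLevel : pureLevel κ α A ⊆ (reidLevel κ α A : Set (Ban k)) := by
  induction α using WellFoundedLT.induction generalizing A with
  | ind α ih =>
    intro V hV
    rcases eq_or_ne α 0 with rfl | hα
    · exact mem_reidLevel_zero.2 (finiteClass_iso (mem_pureLevel_zero.1 hV) base_mem_finiteClass)
    · obtain ⟨I, W, hI, hW, -, hV⟩ := (mem_pureLevel hα).1 hV
      refine (mem_reidLevel hα).2 ⟨I, W, hI, fun i => ?_, hV⟩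
      obtain ⟨β, hβ, B, hB⟩ := hW i
      exact ⟨β, hβ, B, ih β hβ hB⟩

/-- Makes infinitely many pure components force infinite dimension. -/
theorem pureLevel_nontrivial (hV : V ∈ pureLevel κ α A) : Nontrivial V := by
  induction α using WellFoundedLT.induction generalizing A V with
  | ind α ih =>
    rcases eq_or_ne α 0 with rfl | hα
    · obtain ⟨e⟩ := mem_pureLevel_zero.1 hV
      exact e.toEquiv.nontrivial_congr.2 (inferInstanceAs (Nontrivial k))
    · obtain ⟨I, W, -, -, hinf, hV⟩ := (mem_pureLevel hα).1 hV
      obtain ⟨i, ⟨γ, hγ, hi⟩, -⟩ := (hinf 0 (pos_iff_ne_zero.2 hα)).nonempty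
      have := ih γ hγ hi
      obtain ⟨f, g, -, -, hfg⟩ := hV.summand i
      exact (Function.LeftInverse.injective hfg).nontrivial

variable (hκ : ((ℵ₀ : Cardinal.{u}) : WithTop Cardinal.{u}) ≤ κ)
include hκ

omit [IsUltrametricDist k] [CompleteSpace k] in
theorem reidLevel_subset_of_lt (h : β < α) :
    reidLevel κ β B ⊆ (reidLevel κ α A : Set (Ban k)) := fun V hV =>
  (mem_reidLevel (ne_bot_of_gt h)).2 ⟨PUnit, fun _ => V, IsSmall.of_finite hκ,
    fun _ => ⟨β, h, B, hV⟩, HasAgg.of_unique fun _ => V⟩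

omit [IsUltrametricDist k] [CompleteSpace k] in
theorem reidLevel_mono (h : β ≤ α) : reidLevel κ β A ⊆ (reidLevel κ α A : Set (Ban k)) := by
  rcases h.eq_or_lt with rfl | h
  · exact subset_rfl
  · exact reidLevel_subset_of_lt hκ h

theorem prod_mem_reidLevel (hV : V ∈ reidLevel κ α A) (hV' : V' ∈ reidLevel κ α A) :
    V.prod V' ∈ reidLevel κ α A := by
  rcases eq_or_ne α 0 with rfl | hα
  · obtain ⟨d, hd⟩ := (mem_finiteClass_iff .pi).1 (mem_reidLevel_zero.1 hV)
    obtain ⟨d', hd'⟩ := (mem_finiteClass_iff .pi).1 (mem_reidLevel_zero.1 hV')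
    refine mem_reidLevel_zero.2 (mem_finiteClass_of_hasAgg (I := Fin d ⊕ Fin d') (A := .pi) ?_)
    convert hd.sum hd'
    rename_i i
    cases i <;> rfl
  · obtain ⟨I, W, hI, hW, hV⟩ := (mem_reidLevel hα).1 hV
    obtain ⟨I', W', hI', hW', hV'⟩ := (mem_reidLevel hα).1 hV'
    exact (mem_reidLevel hα).2 ⟨I ⊕ I', Sum.elim W W', hI.sum hκ hI', Sum.rec hW hW', hV.sum hV'⟩

theorem zero_mem_reidLevel : Ban.zero k ∈ reidLevel κ α A := by
  refine reidLevel_mono hκ (zero_le (a := α)) (mem_reidLevel_zero.2 ?_)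
  exact mem_finiteClass_of_hasAgg (hasAgg_zero (A := .pi) fun _ : PEmpty.{1} => Ban.base k)

/-- A finite product of members of the levels `α` splits into a member of `Π_α` and a member of
`Σ_α`. -/
theorem exists_iso_prod_of_finite (A : Kind) {I : Type u} [Finite I] {W : I → Ban k}
    (hW : ∀ i, ∃ B, W i ∈ reidLevel κ α B) (hV : HasAgg B V W) :
    ∃ P ∈ reidLevel κ α A, ∃ Q ∈ reidLevel κ α A.dual, V.Iso (P.prod Q) := by
  suffices h : ∃ P ∈ reidLevel κ α .pi, ∃ Q ∈ reidLevel κ α .sigma, V.Iso (P.prod Q) by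
    obtain ⟨P, hP, Q, hQ, h⟩ := h
    cases A
    · exact ⟨P, hP, Q, hQ, h⟩
    · exact ⟨Q, hQ, P, hP, h.trans (Ban.iso_prod_comm P Q)⟩
  revert V W
  refine Finite.induction_empty_option (P := fun I => ∀ {V : Ban k} {W : I → Ban k},
    (∀ i, ∃ B, W i ∈ reidLevel κ α B) → HasAgg B V W →
    ∃ P ∈ reidLevel κ α .pi, ∃ Q ∈ reidLevel κ α .sigma, V.Iso (P.prod Q)) ?_ ?_ ?_ I
  · intro I J e ih V W hW hV
    exact ih (fun i => hW (e i)) (hV.congr (Ban.Iso.refl V) e fun _ => Ban.Iso.refl _)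
  · intro V W _ hV
    exact ⟨_, zero_mem_reidLevel hκ, _, zero_mem_reidLevel hκ,
      (hV.iso (hasAgg_zero W)).trans (Ban.iso_prod_zero _)⟩
  · intro I _ ih V W hW hV
    obtain ⟨P, hP, Q, hQ, h⟩ := ih (fun i => hW (some i))
      (hasAgg_aggregate (fun i => W (some i)) B)
    have h' := hV.iso_option.trans (h.prod (Ban.Iso.refl (W none)))
    obtain ⟨C, hC⟩ := hW none
    cases C
    · refine ⟨P.prod (W none), prod_mem_reidLevel hκ hP hC, Q, hQ, h'.trans ?_⟩
      exact (Ban.iso_prod_assoc _ _ _).trans (((Ban.Iso.refl P).prod (Ban.iso_prod_comm _ _)).trans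
        (Ban.iso_prod_assoc _ _ _).symm)
    · exact ⟨P, hP, Q.prod (W none), prod_mem_reidLevel hκ hQ hC,
        h'.trans (Ban.iso_prod_assoc _ _ _)⟩

/-- A member of `PA_δ`, `δ ≠ 0`, is not a summand, even up to a small perturbation, of a member of
`B_γ`, where `B` is the other symbol and `γ ≤ δ`. -/
theorem not_appRetract (hk : Dense (Set.range fun x : k => ‖x‖₊)) (hmeas : NonMeasurability κ)
    {δ γ : Ordinal.{u}} {X : Ban k} (hV : V ∈ pureLevel κ δ A) (hδ : δ ≠ 0) (hγ : γ ≤ δ)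
    (hX : X ∈ reidLevel κ γ A.dual) : ¬ AppRetract V X := by
  induction δ using WellFoundedLT.induction generalizing A V X γ with
  | ind δ ih =>
    intro hVX
    obtain ⟨I, W, hI, -, hinf, hV⟩ := (mem_pureLevel hδ).1 hV
    have hfd : ∀ {B} {Y : Ban k}, Y ∈ reidLevel κ 0 B → Module.Finite k Y := fun hY => by
      obtain ⟨d, ⟨e⟩⟩ := mem_reidLevel_zero.1 hY
      exact Module.Finite.equiv e.toLinearEquiv.symm
    have hδ0 : 0 < δ := pos_iff_ne_zero.2 hδ
    have hnt : ∀ i ∈ {i | (∃ γ < δ, W i ∈ pureLevel κ γ A.dual) ∧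
        ¬ ∃ γ < (0 : Ordinal.{u}), W i ∈ pureLevel κ γ A.dual}, Nontrivial (W i) :=
      fun i ⟨⟨_, _, hi⟩, _⟩ => pureLevel_nontrivial hi
    rcases eq_or_ne γ 0 with rfl | hγ0
    · have := hfd hX
      exact hinf 0 hδ0 ((hV.finite_of_module_finite hVX).subset hnt)
    obtain ⟨J, U, hJ, hU, hX⟩ := (mem_reidLevel hγ0).1 hX
    -- First cut: only finitely many components of `X` remain, so their levels have a common bound
    -- `β < γ`.
    obtain ⟨D, F, hDF⟩ := (hVX.trans_summand (Summand.prod_left X (Ban.zero k))).exists_finset hk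
      (fun _ h => hmeas.eq_pure hI _ h) (fun _ h => hmeas.eq_pure hJ _ h) hV hX
    choose b hb B hB using hU
    obtain ⟨β, hβ, hbβ⟩ : ∃ β < γ, ∀ j ∈ F, b j ≤ β :=
      ⟨F.sup b, (Finset.sup_lt_iff (pos_iff_ne_zero.2 hγ0)).2 fun j _ => hb j,
        fun j hj => Finset.le_sup hj⟩
    obtain ⟨P, hP, Q, hQ, hPQ⟩ := exists_iso_prod_of_finite hκ A
      (fun j : (F : Set J) => ⟨B j, reidLevel_mono hκ (hbβ j j.2) (hB j)⟩)
      (hasAgg_aggregate (fun j : (F : Set J) => U j) A.dual)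
    -- `Q` is put in front because it has the kind opposite to `A` and is the factor to be cut next.
    have hret := hDF.trans_summand (((Ban.iso_prod_zero _).symm.trans
      (hPQ.trans (Ban.iso_prod_comm P Q))).summand)
    have hV1 := hasAgg_aggregate (fun i : ((D : Set I)ᶜ : Set I) => W i) A
    rcases eq_or_ne β 0 with rfl | hβ0
    · have := hfd (prod_mem_reidLevel hκ hQ (mem_reidLevel_zero.2 (mem_reidLevel_zero.1 hP)))
      have hfin := (hV1.finite_of_module_finite hret).image Subtype.val
      refine hinf 0 hδ0 ((hfin.union D.finite_toSet).subset fun i hi => ?_)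
      by_cases hiD : i ∈ (D : Set I)
      · exact Or.inr hiD
      · exact Or.inl ⟨⟨i, hiD⟩, hnt i hi, rfl⟩
    obtain ⟨J', U', hJ', hU', hQ'⟩ := (mem_reidLevel hβ0).1 hQ
    obtain ⟨D', F', hDF'⟩ := hret.exists_finset hk
      (fun _ h => hmeas.eq_pure (hI.of_injective Subtype.val_injective) _ h)
      (fun _ h => hmeas.eq_pure hJ' _ h) hV1 hQ'
    -- After the second cut the remainder of `Q` is a finite aggregate, which also counts as one of
    -- kind `A`; with `P` it lies in level `β` of kind `A`.
    have hT : (aggregate A.dual fun j : (F' : Set J') => U' j).prod P ∈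
        reidLevel κ β A.dual.dual := by
      have hAA : A.dual.dual = A := by cases A <;> rfl
      rw [hAA]
      refine prod_mem_reidLevel hκ ((mem_reidLevel hβ0).2 ⟨(F' : Set J'), fun j => U' j,
        IsSmall.of_finite hκ, fun j => hU' j, (hasAgg_aggregate _ A.dual).of_finite⟩) hP
    -- Purity supplies a component of the opposite kind and rank `ε` with `β ≤ ε < δ` outside both
    -- exceptional sets; it contradicts the induction hypothesis.
    obtain ⟨i, ⟨⟨ε, hε, hi⟩, hiβ⟩, hiD⟩ := ((hinf β (hβ.trans_le hγ)).sdiff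
      ((D'.finite_toSet.image Subtype.val).union D.finite_toSet)).nonempty
    rw [Set.mem_union, not_or] at hiD
    have hβε : β ≤ ε := not_lt.1 fun h => hiβ ⟨ε, h, hi⟩
    have hi' : (⟨i, hiD.2⟩ : ((D : Set I)ᶜ : Set I)) ∈ ((D' : Set _)ᶜ : Set _) :=
      fun h => hiD.1 ⟨_, h, rfl⟩
    refine ih ε hε hi ((pos_iff_ne_zero.2 hβ0).trans_le hβε).ne' hβε hT ?_
    exact ((hasAgg_aggregate (fun i : ((D' : Set ((D : Set I)ᶜ : Set I))ᶜ : Set _) => W i.1)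
      A).summand ⟨_, hi'⟩).trans_appRetract hDF'

end levels

/-! ### Disjointness of the parts -/

section classification

variable [IsUltrametricDist k] [CompleteSpace k]
variable {κ : WithTop Cardinal.{u}} {α β : Ordinal.{u}} {A B : Kind} {V V' : Ban k}

/-- The ordinal in the label of a part, which is `0` for `F_k`. -/
def Part.ord : Part.{u} → Ordinal.{u}
  | .finite => 0
  | .mixed α _ => α
  | .pi α _ => α
  | .sigma α _ => α

theorem part_iso {p : Part.{u}} (h : V.Iso V') (hV : V' ∈ part k κ p) : V ∈ part k κ p := by
  cases p with
  | finite => exact finiteClass_iso h hV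
  | mixed α hα =>
    obtain ⟨P, hP, S, hS, hV⟩ := hV
    exact ⟨P, hP, S, hS, h.trans (W := P.prod S) hV⟩
  | pi α hα => exact pureLevel_iso h hV
  | sigma α hα => exact pureLevel_iso h hV

omit [IsUltrametricDist k] [CompleteSpace k] in
theorem exists_summand_of_mem_part {p : Part.{u}} (hV : V ∈ part k κ p) (hp : p.ord ≠ 0) :
    ∃ A, ∃ P ∈ pureLevel κ p.ord A, Summand P V := by
  cases p with
  | finite => exact absurd rfl hp
  | mixed α hα =>
    obtain ⟨P, hP, S, hS, hV⟩ := hV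
    obtain ⟨e⟩ : V.Iso (P.prod S) := hV
    refine ⟨.pi, P, hP, e.symm.toLinearEquiv ∘ₗ Ban.inl P S, Ban.fst P S ∘ₗ e.toLinearEquiv,
      fun x => ?_, fun y => ?_, fun x => ?_⟩
    · exact ((e.symm.norm_map _).trans (Ban.norm_inl P S x)).le
    · exact (Ban.norm_fst_le _).trans (e.norm_map y).le
    · exact congrArg (Ban.fst P S) (e.apply_symm_apply (Ban.inl P S x))
  | pi α hα => exact ⟨.pi, V, hV, (Ban.Iso.refl V).summand⟩
  | sigma α hα => exact ⟨.sigma, V, hV, (Ban.Iso.refl V).summand⟩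

omit [IsUltrametricDist k] [CompleteSpace k] in
theorem mem_part_of_mem_pureLevel (hα : α ≠ 0) (hV : V ∈ pureLevel κ α A) :
    ∃ p, V ∈ part k κ p := by
  cases A
  · exact ⟨.pi α hα, hV⟩
  · exact ⟨.sigma α hα, hV⟩

section disjoint

variable (hκ : ((ℵ₀ : Cardinal.{u}) : WithTop Cardinal.{u}) ≤ κ)
include hκ

/-- Passing to a strictly higher level makes the kind irrelevant, so both factors of a mixed space
fit into one level. -/
theorem mem_reidLevel_of_mem_part {p : Part.{u}} (hV : V ∈ part k κ p) (hα : p.ord < α) :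
    V ∈ reidLevel κ α A := by
  cases p with
  | finite => exact reidLevel_subset_of_lt hκ hα (B := .pi) (mem_reidLevel_zero.2 hV)
  | mixed β hβ =>
    obtain ⟨P, hP, S, hS, hV⟩ := hV
    exact reidLevel_iso (V' := P.prod S) hV (prod_mem_reidLevel hκ
      (reidLevel_subset_of_lt hκ hα (pureLevel_subset_reidLevel hP))
      (reidLevel_subset_of_lt hκ hα (pureLevel_subset_reidLevel hS)))
  | pi β hβ => exact reidLevel_subset_of_lt hκ hα (pureLevel_subset_reidLevel hV)
  | sigma β hβ => exact reidLevel_subset_of_lt hκ hα (pureLevel_subset_reidLevel hV)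

variable (hk : Dense (Set.range fun x : k => ‖x‖₊)) (hmeas : NonMeasurability κ)
include hk hmeas

/-- Otherwise `V` has a pure summand of rank `p.ord`, yet by its label `q` it lies in that Reid
level for both kinds. -/
theorem ord_le_of_mem_part {p q : Part.{u}} (hp : V ∈ part k κ p) (hq : V ∈ part k κ q) :
    p.ord ≤ q.ord := by
  by_contra! hlt
  obtain ⟨A, P, hP, hPV⟩ := exists_summand_of_mem_part hp (ne_bot_of_gt hlt)
  exact not_appRetract hκ hk hmeas hP (ne_bot_of_gt hlt) le_rfl
    (mem_reidLevel_of_mem_part hκ hq hlt) hPV.appRetract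

theorem not_mem_pureLevel_dual (hα : α ≠ 0) (hV : V ∈ pureLevel κ α A) (h : Summand V V') :
    V' ∉ pureLevel κ α A.dual := fun hV' =>
  not_appRetract hκ hk hmeas hV hα le_rfl (pureLevel_subset_reidLevel hV') h.appRetract

/-- The ranks agree. At equal rank a mixed space has pure summands of both kinds, and each excludes
the pure class of the other kind. -/
theorem part_disjoint {p q : Part.{u}} (hpq : p ≠ q) :
    Disjoint (part k κ p) (part k κ q) := by
  refine Set.disjoint_left.2 fun V hp hq => ?_
  have hord := (ord_le_of_mem_part hκ hk hmeas hp hq).antisymm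
    (ord_le_of_mem_part hκ hk hmeas hq hp)
  have hmix : ∀ {α}, α ≠ 0 → V ∈ mixedClass k κ α → ∀ A, V ∉ pureLevel κ α A := by
    rintro α hα ⟨P, hP, S, hS, hV⟩ A hA
    have hV : V.Iso (P.prod S) := hV
    cases A
    · exact not_mem_pureLevel_dual hκ hk hmeas hα hS (Summand.prod_left S P)
        (pureLevel_iso ((Ban.iso_prod_comm S P).trans hV.symm) hA)
    · exact not_mem_pureLevel_dual hκ hk hmeas hα hP (Summand.prod_left P S)
        (pureLevel_iso hV.symm hA)
  have hps : ∀ {α}, α ≠ 0 → V ∈ purePi k κ α → V ∉ pureSigma k κ α := fun hα hV =>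
    not_mem_pureLevel_dual hκ hk hmeas hα hV (Ban.Iso.refl V).summand
  cases p <;> cases q <;> simp only [Part.ord] at hord <;> subst_vars <;>
    first
    | exact hpq rfl
    | contradiction
    | exact hmix ‹_› hp _ hq
    | exact hmix ‹_› hq _ hp
    | exact hps ‹_› hp hq
    | exact hps ‹_› hq hp

theorem not_mem_pureLevel_of_lt (h : β < α) (hV : V ∈ pureLevel κ α A) :
    V ∉ pureLevel κ β B := fun hV' =>
  not_appRetract hκ hk hmeas hV (ne_bot_of_gt h) le_rfl
    (reidLevel_subset_of_lt hκ h (pureLevel_subset_reidLevel hV')) (Ban.Iso.refl V).summand.appRetract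

end disjoint

/-! ### Absorption of factors -/

section absorption

variable (hκ : ((ℵ₀ : Cardinal.{u}) : WithTop Cardinal.{u}) ≤ κ)
include hκ

omit [IsUltrametricDist k] [CompleteSpace k] in
-- Extra components of lower rank do not disturb a condition that only asks for infinitely many
-- components.
theorem prod_mem_pureLevel (hα : α ≠ 0) (hV : V ∈ pureLevel κ α A) {I' : Type u} {W' : I' → Ban k}
    (hI' : IsSmall κ I') (hW' : ∀ i, ∃ β < α, ∃ B, W' i ∈ pureLevel κ β B)
    (hV' : HasAgg A V' W') : V.prod V' ∈ pureLevel κ α A := by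
  obtain ⟨I, W, hI, hW, hinf, hV⟩ := (mem_pureLevel hα).1 hV
  refine (mem_pureLevel hα).2 ⟨I ⊕ I', Sum.elim W W', hI.sum hκ hI', Sum.rec hW hW',
    fun β hβ hfin => ?_, hV.sum hV'⟩
  exact hinf β hβ (Set.Finite.preimage (f := Sum.inl) Sum.inl_injective.injOn hfin)

omit [IsUltrametricDist k] [CompleteSpace k] in
theorem prod_mem_pureLevel_of_lt (h : β < α) (hV : V ∈ pureLevel κ α A)
    (hV' : V' ∈ pureLevel κ β B) : V.prod V' ∈ pureLevel κ α A :=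
  prod_mem_pureLevel hκ (ne_bot_of_gt h) hV (IsSmall.of_finite hκ) (fun _ => ⟨β, h, B, hV'⟩)
    (HasAgg.of_unique fun _ : PUnit.{u + 1} => V')

omit [IsUltrametricDist k] [CompleteSpace k] in
theorem prod_mem_pureLevel_self (hα : α ≠ 0) (hV : V ∈ pureLevel κ α A)
    (hV' : V' ∈ pureLevel κ α A) : V.prod V' ∈ pureLevel κ α A := by
  obtain ⟨I', W', hI', hW', -, hV'⟩ := (mem_pureLevel hα).1 hV'
  exact prod_mem_pureLevel hκ hα hV hI' hW' hV'

theorem prod_mem_pureLevel_of_finite (hα : α ≠ 0) (hV : V ∈ pureLevel κ α A)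
    (hV' : V' ∈ finiteClass k) : V.prod V' ∈ pureLevel κ α A := by
  obtain ⟨d, hd⟩ := (mem_finiteClass_iff A).1 hV'
  exact prod_mem_pureLevel hκ hα hV (IsSmall.of_finite hκ)
    (fun _ => ⟨0, pos_iff_ne_zero.2 hα, .pi, mem_pureLevel_zero.2 (Ban.Iso.refl _)⟩)
    (hd.congr (Ban.Iso.refl _) Equiv.ulift.{u} fun _ => Ban.Iso.refl _)

theorem prod_pureLevel_mem_part (hV : V ∈ pureLevel κ α A) (hV' : V' ∈ pureLevel κ β B)
    (hα : α ≠ 0) (hβ : β ≠ 0) : ∃ p, V.prod V' ∈ part k κ p := by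
  rcases lt_trichotomy α β with h | rfl | h
  · exact mem_part_of_mem_pureLevel hβ
      (pureLevel_iso (Ban.iso_prod_comm _ _) (prod_mem_pureLevel_of_lt hκ h hV' hV))
  · cases A <;> cases B
    · exact mem_part_of_mem_pureLevel hα (prod_mem_pureLevel_self hκ hα hV hV')
    · exact ⟨.mixed α hα, V, hV, V', hV', Ban.Iso.refl (V.prod V')⟩
    · exact ⟨.mixed α hα, V', hV', V, hV, Ban.iso_prod_comm V V'⟩
    · exact mem_part_of_mem_pureLevel hα (prod_mem_pureLevel_self hκ hα hV hV')
  · exact mem_part_of_mem_pureLevel hα (prod_mem_pureLevel_of_lt hκ h hV hV')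

/-- The factor of larger rank absorbs the other. At equal rank, equal kinds merge and different
kinds give a mixed space. -/
theorem prod_mem_part {p : Part.{u}} (hV : V ∈ part k κ p) (hV' : V' ∈ pureLevel κ β B) :
    ∃ p, V.prod V' ∈ part k κ p := by
  have hcomm := Ban.iso_prod_comm V V'
  have pure : ∀ {α A}, α ≠ 0 → V ∈ pureLevel κ α A → ∃ p, V.prod V' ∈ part k κ p := by
    intro α A hα hV
    rcases eq_or_ne β 0 with rfl | hβ
    · exact mem_part_of_mem_pureLevel hα
        (prod_mem_pureLevel_of_lt hκ (pos_iff_ne_zero.2 hα) hV hV')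
    · exact prod_pureLevel_mem_part hκ hV hV' hα hβ
  cases p with
  | finite =>
    rcases eq_or_ne β 0 with rfl | hβ
    · refine ⟨.finite, mem_reidLevel_zero.1 (prod_mem_reidLevel hκ (A := B)
        (mem_reidLevel_zero.2 hV) (pureLevel_subset_reidLevel hV'))⟩
    · exact mem_part_of_mem_pureLevel hβ
        (pureLevel_iso hcomm (prod_mem_pureLevel_of_finite hκ hβ hV' hV))
  | mixed α hα =>
    obtain ⟨P, hP, S, hS, hV⟩ := hV
    have hV : V.Iso (P.prod S) := hV
    have h1 : (V.prod V').Iso (P.prod (S.prod V')) :=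
      (hV.prod (Ban.Iso.refl V')).trans (Ban.iso_prod_assoc _ _ _)
    have h2 : (V.prod V').Iso ((P.prod V').prod S) :=
      h1.trans (((Ban.Iso.refl P).prod (Ban.iso_prod_comm _ _)).trans
        (Ban.iso_prod_assoc _ _ _).symm)
    rcases lt_trichotomy α β with h | rfl | h
    · refine mem_part_of_mem_pureLevel (ne_bot_of_gt h) (pureLevel_iso (h2.trans
        ((Ban.iso_prod_comm P V').prod (Ban.Iso.refl S)))
        (prod_mem_pureLevel_of_lt hκ h (prod_mem_pureLevel_of_lt hκ h hV' hP) hS))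
    · cases B
      · exact ⟨.mixed α hα, _, prod_mem_pureLevel_self hκ hα hP hV', S, hS, h2⟩
      · exact ⟨.mixed α hα, P, hP, _, prod_mem_pureLevel_self hκ hα hS hV', h1⟩
    · exact ⟨.mixed α hα, P, hP, _, prod_mem_pureLevel_of_lt hκ h hS hV', h1⟩
  | pi α hα => exact pure hα hV
  | sigma α hα => exact pure hα hV

theorem prod_mem_part_of_finite {I : Type u} [Finite I] {W : I → Ban k}
    (hW : ∀ i, ∃ β B, W i ∈ pureLevel κ β B) (hV : ∃ p, V ∈ part k κ p) (hV' : HasAgg A V' W) :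
    ∃ p, V.prod V' ∈ part k κ p := by
  revert V V' W
  refine Finite.induction_empty_option (P := fun I => ∀ {V V' : Ban k} {W : I → Ban k},
    (∀ i, ∃ β B, W i ∈ pureLevel κ β B) → (∃ p, V ∈ part k κ p) → HasAgg A V' W →
      ∃ p, V.prod V' ∈ part k κ p) ?_ ?_ ?_ I
  · intro I J e ih V V' W hW hV hV'
    exact ih (fun i => hW (e i)) hV (hV'.congr (Ban.Iso.refl V') e fun _ => Ban.Iso.refl _)
  · rintro V V' W - ⟨p, hp⟩ hV'
    exact ⟨p, part_iso (((Ban.Iso.refl V).prod (hV'.iso (hasAgg_zero W))).trans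
      (Ban.iso_prod_zero V).symm) hp⟩
  · intro I _ ih V V' W hW hV hV'
    obtain ⟨p, hp⟩ := ih (fun i => hW (some i)) hV (hasAgg_aggregate (fun i => W (some i)) A)
    obtain ⟨β, B, hB⟩ := hW none
    obtain ⟨q, hq⟩ := prod_mem_part hκ hp hB
    exact ⟨q, part_iso (((Ban.Iso.refl V).prod hV'.iso_option).trans
      (Ban.iso_prod_assoc _ _ _).symm) hq⟩

end absorption

/-! ### Exhaustion of the Reid class -/

variable (k) in
/-- The aggregates of kind `A` of members of the pure levels of the other kind. -/
def dualAgg (κ : WithTop Cardinal.{u}) (A : Kind) : Set (Ban k) :=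
  {V | ∃ (I : Type u) (W : I → Ban k), IsSmall κ I ∧ (∀ i, ∃ β, W i ∈ pureLevel κ β A.dual) ∧
    HasAgg A V W}

section exhaustion

variable (hκ : ((ℵ₀ : Cardinal.{u}) : WithTop Cardinal.{u}) ≤ κ)
include hκ

theorem mem_part_of_mem_dualAgg (hk : Dense (Set.range fun x : k => ‖x‖₊))
    (hmeas : NonMeasurability κ) (hV : V ∈ dualAgg k κ A) : ∃ p, V ∈ part k κ p := by
  obtain ⟨I, W, hI, hW, hV⟩ := hV
  choose b hb using hW
  have hne : {α : Ordinal.{u} | {i | α ≤ b i}.Finite}.Nonempty := by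
    obtain ⟨α, hα⟩ := Ordinal.bddAbove_of_small (s := Set.range b)
    refine ⟨Order.succ α, Set.Finite.subset Set.finite_empty fun i hi => ?_⟩
    exact absurd (Order.succ_le_iff.1 hi) (not_lt.2 (hα ⟨i, rfl⟩))
  -- Below this threshold infinitely many components have rank at least any given `β < α`. Removing
  -- the finitely many of rank at least `α` leaves the purity condition intact.
  set α := sInf {α : Ordinal.{u} | {i | α ≤ b i}.Finite}
  have hfin : {i | α ≤ b i}.Finite := csInf_mem hne
  have hinf : ∀ β < α, {i | β ≤ b i}.Infinite := fun β hβ hβ' =>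
    (csInf_le' (s := {α : Ordinal.{u} | {i | α ≤ b i}.Finite}) hβ').not_gt hβ
  have : Finite {i // ¬ b i < α} := (hfin.subset fun i hi => not_lt.1 hi).to_subtype
  have hP : ∃ p, (aggregate A fun i : {i // b i < α} => W i) ∈ part k κ p := by
    rcases eq_or_ne α 0 with h0 | h0
    · have : IsEmpty {i // b i < α} := ⟨fun i => by simpa [h0] using i.2⟩
      exact ⟨.finite, finiteClass_iso ((hasAgg_aggregate _ A).iso (hasAgg_zero _))
        (mem_reidLevel_zero.1 (zero_mem_reidLevel hκ (A := .pi)))⟩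
    · refine mem_part_of_mem_pureLevel h0 ((mem_pureLevel h0).2 ⟨_, _,
        hI.of_injective Subtype.val_injective, fun i => ⟨b i, i.2, A.dual, hb i⟩,
        fun β hβ hcon => ?_, hasAgg_aggregate _ A⟩)
      refine (hinf β hβ).sdiff hfin ((hcon.image Subtype.val).subset ?_)
      rintro i ⟨hi1, hi2⟩
      refine ⟨⟨i, not_le.1 hi2⟩, ⟨⟨b i, not_le.1 hi2, hb i⟩, ?_⟩, rfl⟩
      rintro ⟨γ, hγ, hiγ⟩
      -- Invariance of the rank: a component of rank `b i ≥ β` cannot also occur at a level below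
      -- `β`.
      exact not_mem_pureLevel_of_lt hκ hk hmeas (hγ.trans_le hi1) (hb i) hiγ
  obtain ⟨p, hp⟩ := prod_mem_part_of_finite hκ
    (fun i : {i // ¬ b i < α} => ⟨b i, A.dual, hb i⟩) hP (hasAgg_aggregate _ A)
  exact ⟨p, part_iso (hV.iso_subtype _) hp⟩

omit [IsUltrametricDist k] [CompleteSpace k] in
theorem pureLevel_dual_subset_dualAgg : pureLevel κ α A.dual ⊆ dualAgg k κ A := fun V hV =>
  ⟨PUnit, fun _ => V, IsSmall.of_finite hκ, fun _ => ⟨α, hV⟩, HasAgg.of_unique fun _ => V⟩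

omit [IsUltrametricDist k] [CompleteSpace k] hκ in
theorem mem_dualAgg_of_hasAgg
    (hreg : ∀ c : Cardinal.{u}, κ = (c : WithTop Cardinal.{u}) → c.IsRegular) {I : Type u}
    {W : I → Ban k} (hI : IsSmall κ I) (hW : ∀ i, W i ∈ dualAgg k κ A) (hV : HasAgg A V W) :
    V ∈ dualAgg k κ A := by
  choose J U hJ hU hW using hW
  exact ⟨Σ i, J i, fun p => U p.1 p.2, hI.sigma hreg hJ, fun p => hU p.1 p.2, hV.sigma hW⟩

variable (hreg : ∀ c : Cardinal.{u}, κ = (c : WithTop Cardinal.{u}) → c.IsRegular)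
include hreg

/-- A space of the opposite kind is an aggregate over one index; one of kind `A` is flattened after
its components have been rewritten. At level 0 the kind is immaterial. -/
theorem pureLevel_subset_dualAgg : pureLevel κ α B ⊆ dualAgg k κ A := by
  induction α using WellFoundedLT.induction generalizing B with
  | ind α ih =>
    intro V hV
    rcases eq_or_ne α 0 with rfl | hα
    · exact pureLevel_dual_subset_dualAgg hκ (mem_pureLevel_zero.2 (mem_pureLevel_zero.1 hV))
    · by_cases hBA : B = A
      · subst hBA
        obtain ⟨I, W, hI, hW, -, hV⟩ := (mem_pureLevel hα).1 hV
        refine mem_dualAgg_of_hasAgg hreg hI (fun i => ?_) hV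
        obtain ⟨β, hβ, C, hC⟩ := hW i
        exact ih β hβ hC
      · obtain rfl : B = A.dual := by cases A <;> cases B <;> first | rfl | exact absurd rfl hBA
        exact pureLevel_dual_subset_dualAgg hκ hV

theorem part_subset_dualAgg (p : Part.{u}) : part k κ p ⊆ dualAgg k κ A := by
  intro V hV
  cases p with
  | finite =>
    obtain ⟨d, hd⟩ := (mem_finiteClass_iff A).1 hV
    exact ⟨ULift (Fin d), fun _ => Ban.base k, IsSmall.of_finite hκ,
      fun _ => ⟨0, mem_pureLevel_zero.2 (Ban.Iso.refl _)⟩,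
      hd.congr (Ban.Iso.refl V) Equiv.ulift fun _ => Ban.Iso.refl _⟩
  | mixed α hα =>
    obtain ⟨P, hP, S, hS, hV⟩ := hV
    have hV : V.Iso (P.prod S) := hV
    refine mem_dualAgg_of_hasAgg hreg (IsSmall.of_finite hκ) (W := Sum.elim (fun _ => P) fun _ => S)
      (Sum.rec (fun _ => pureLevel_subset_dualAgg hκ hreg hP)
        fun _ => pureLevel_subset_dualAgg hκ hreg hS)
      (((HasAgg.of_unique fun _ : PUnit.{u + 1} => P).sum
        (HasAgg.of_unique fun _ : PUnit.{u + 1} => S)).congr hV (Equiv.refl _)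
          fun _ => Ban.Iso.refl _)
  | pi α hα => exact pureLevel_subset_dualAgg hκ hreg hV
  | sigma α hα => exact pureLevel_subset_dualAgg hκ hreg hV

/-- By induction every component lies in a part, hence is an aggregate of the same kind `A` as the
outer one, with pure components of the other kind; flattening leaves a single aggregate to classify.
-/
theorem mem_part_of_mem_reidLevel (hk : Dense (Set.range fun x : k => ‖x‖₊))
    (hmeas : NonMeasurability κ) (hV : V ∈ reidLevel κ α A) : ∃ p, V ∈ part k κ p := by
  induction α using WellFoundedLT.induction generalizing A V with
  | ind α ih =>
    rcases eq_or_ne α 0 with rfl | hα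
    · exact ⟨.finite, mem_reidLevel_zero.1 hV⟩
    · obtain ⟨I, W, hI, hW, hV⟩ := (mem_reidLevel hα).1 hV
      refine mem_part_of_mem_dualAgg hκ hk hmeas (mem_dualAgg_of_hasAgg hreg hI (fun i => ?_) hV)
      obtain ⟨β, hβ, B, hB⟩ := hW i
      obtain ⟨p, hp⟩ := ih β hβ hB
      exact part_subset_dualAgg hκ hreg p hp

end exhaustion

end classification

end NAReid

end

theorem mainTheorem1 {k : Type u} [NormedField k] [IsUltrametricDist k] [CompleteSpace k]
    (hk : Dense (Set.range fun x : k => ‖x‖₊))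
    (κ : WithTop Cardinal.{u}) (hκ : ((ℵ₀ : Cardinal.{u}) : WithTop Cardinal.{u}) ≤ κ)
    (hmeas : NAReid.NonMeasurability κ) :
    (∀ p : NAReid.Part.{u}, NAReid.part k κ p ⊆ NAReid.reidClass k κ) ∧
    (∀ p q : NAReid.Part.{u}, p ≠ q → Disjoint (NAReid.part k κ p) (NAReid.part k κ q)) ∧
    ((∀ c : Cardinal.{u}, κ = (c : WithTop Cardinal.{u}) → c.IsRegular) →
      NAReid.reidClass k κ = ⋃ p : NAReid.Part.{u}, NAReid.part k κ p) := by
  have hsub : ∀ p : NAReid.Part.{u}, NAReid.part k κ p ⊆ NAReid.reidClass k κ := fun p V hV =>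
    ⟨Order.succ p.ord, .pi, NAReid.mem_reidLevel_of_mem_part hκ hV (Order.lt_succ _)⟩
  refine ⟨hsub, fun p q => NAReid.part_disjoint hκ hk hmeas, fun hreg => ?_⟩
  refine Set.Subset.antisymm ?_ (Set.iUnion_subset hsub)
  rintro V ⟨α, A, hV⟩
  exact Set.mem_iUnion.2 (NAReid.mem_part_of_mem_reidLevel hκ hreg hk hmeas hV)
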